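/- Let $d,k\ge 1$ be integers with $k>d/2$ and let $c>1$. A cube is a set $B=\prod_{i=1}^d[a_i,a_i+h)\subseteq[0,1]^d$ with $0<h\le 1$; its volume is $|B|=h^d$. A system $\mathcal B$ of cubes is normal with constant $c$ if every cube $B$ contains a cube $\tilde B\in\mathcal B$ with $|\tilde B|\ge |B|/c$. For $n=N^d$ with $N\in\mathbb N$ let $\Gamma_n=\{(\tau_1/N,\dots,\tau_d/N):\tau_i\in\{0,\dots,N-1\}\}$, let $S_nf=(f(x))_{x\in\Gamma_n}$, and for $y\in\mathbb R^{\Gamma_n}$ let $$\|y\|_{\mathcal B}=\sup_{B\in\mathcal B}\frac{1}{\sqrt{n(B)}}\Bigl|\sum_{x\in\Gamma_n\cap B}y(x)\Bigr|,\qquad n(B)=\#(\Gamma_n\cap B),$$ where terms with $n(B)=0$ are zero. For $1\le q\le\infty$ put $$\vartheta=\begin{cases}\dfrac{k}{2k+d}&\text{if } q\le \dfrac{4k+2d}{d},\\[2mm] \dfrac{k-d/2+d/q}{2k}&\text{if } q\ge\dfrac{4k+2d}{d},\end{cases}\qquad \vartheta'=\frac{2k\vartheta}{d}.$$ Then there are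 constants $C>0$ and $n_0\in\mathbb N$, depending only on $k$, $d$ and $c$, such that for every system of cubes $\mathcal B$ that is normal with constant $c$, every $1\le q\le\infty$, every continuous $f:[0,1]^d\to\mathbb R$ whose weak partial derivatives of order $k$ on $(0,1)^d$ exist and belong to $L^2$, and every $n=N^d\ge n_0$, $$\|f\|_{L^q}\le C\max\Bigl\{\frac{\|S_nf\|_{\mathcal B}^{2\vartheta}}{n^{\vartheta}}\,\|D^kf\|_{L^2}^{1-2\vartheta},\ \frac{\|S_nf\|_{\mathcal B}}{n^{1/2}},\ \frac{\|D^kf\|_{L^2}}{n^{\vartheta'}}\Bigr\}.$$ Here the norms are over the unit cube and $\|D^kf\|_{L^2}$ is the $L^2$-norm of the Euclidean length of the tensor of all partial derivatives of order $k$ of $f$. -/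

import Mathlib

open MeasureTheory
open scoped ENNReal ContDiff

noncomputable section

namespace MultiresolutionNorm

/-- A cube: a nonempty half-open cube `∏ i, [a i, a i + h)` with `0 < h ≤ 1`, contained in
`[0,1]^d`. -/
def IsCube {d : ℕ} (B : Set (Fin d → ℝ)) : Prop :=
  ∃ (a : Fin d → ℝ) (h : ℝ), 0 < h ∧ h ≤ 1 ∧
    B = Set.univ.pi (fun i => Set.Ico (a i) (a i + h)) ∧ B ⊆ Set.Icc 0 1

/-- `𝓑` is a normal system of cubes with normality constant `c`: every cube `B` contains a cube
`B'` of the system with `|B'| ≥ |B| / c`. -/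
structure IsNormalSystem {d : ℕ} (c : ℝ) (𝓑 : Set (Set (Fin d → ℝ))) : Prop where
  one_lt : 1 < c
  isCube : ∀ B ∈ 𝓑, IsCube B
  exists_subset : ∀ B : Set (Fin d → ℝ), IsCube B →
    ∃ B' ∈ 𝓑, B' ⊆ B ∧ volume.real B / c ≤ volume.real B'

/-- The points `(τ₁/N, …, τ_d/N)`, `τ_i = 0, …, N - 1`, of the regular grid `Γ_n` in `[0,1]^d` with
`n = N ^ d` points. Vectors in `ℝ^{Γ_n}` are indexed by `τ`. -/
def gridPoint {d : ℕ} (N : ℕ) (τ : Fin d → Fin N) : Fin d → ℝ :=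
  fun i => ((τ i : ℕ) : ℝ) / (N : ℝ)

/-- The sampling operator `S_n`: evaluation at the points of the grid `Γ_n`, `n = N ^ d`. -/
def sample {d : ℕ} (N : ℕ) (f : (Fin d → ℝ) → ℝ) : (Fin d → Fin N) → ℝ :=
  fun τ => f (gridPoint N τ)

open Classical in
/-- The (indices of the) grid points that lie in `B`; its cardinality is `n(B)`. -/
def gridIn {d : ℕ} (N : ℕ) (B : Set (Fin d → ℝ)) : Finset (Fin d → Fin N) :=
  Finset.univ.filter (fun τ => gridPoint N τ ∈ B)

/-- The normalized local sum `n(B)^{-1/2} |∑_{x ∈ Γ_n ∩ B} y(x)|`, which is zero (as `0 / 0`) if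
`n(B) = 0`. -/
def localSum {d N : ℕ} (y : (Fin d → Fin N) → ℝ) (B : Set (Fin d → ℝ)) : ℝ :=
  |∑ τ ∈ gridIn N B, y τ| / Real.sqrt ((gridIn N B).card : ℝ)

/-- The multiresolution norm `‖y‖_𝓑 = sup_{B ∈ 𝓑} n(B)^{-1/2} |∑_{x ∈ Γ_n ∩ B} y(x)|`. -/
def mrNorm {d N : ℕ} (𝓑 : Set (Set (Fin d → ℝ))) (y : (Fin d → Fin N) → ℝ) : ℝ :=
  ⨆ B : 𝓑, localSum y (B : Set (Fin d → ℝ))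

/-- The supremum in the multiresolution norm is over a bounded set of reals. -/
theorem bddAbove_localSum {d N : ℕ} (𝓑 : Set (Set (Fin d → ℝ))) (y : (Fin d → Fin N) → ℝ) :
    BddAbove (Set.range fun B : 𝓑 => localSum y (B : Set (Fin d → ℝ))) := by
  refine ⟨∑ τ, |y τ|, ?_⟩
  rintro _ ⟨B, rfl⟩
  have h1 : |∑ τ ∈ gridIn N (B : Set (Fin d → ℝ)), y τ| ≤ ∑ τ, |y τ| :=
    (Finset.abs_sum_le_sum_abs _ _).trans
      (Finset.sum_le_sum_of_subset_of_nonneg (Finset.subset_univ _) fun _ _ _ => abs_nonneg _)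
  have h0 : 0 ≤ ∑ τ, |y τ| := Finset.sum_nonneg fun _ _ => abs_nonneg _
  rcases Nat.eq_zero_or_pos (gridIn N (B : Set (Fin d → ℝ))).card with h | h
  · simpa [localSum, h] using h0
  · refine (div_le_self (abs_nonneg _) ?_).trans h1
    rw [Real.one_le_sqrt]
    exact_mod_cast h

/-- The open unit cube `(0,1)^d`. -/
def openCube (d : ℕ) : Set (Fin d → ℝ) :=
  Set.univ.pi fun _ => Set.Ioo 0 1

/-- The family `g`, indexed by `α : Fin k → Fin d`, is the weak `k`-th derivative `D^k f` of `f` on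
`(0,1)^d`: `g α` is the weak partial derivative `∂_{α 0} ⋯ ∂_{α (k-1)} f`, that is,
`∫ f ∂^α φ = (-1)^k ∫ (g α) φ` for all test functions `φ ∈ C_c^∞((0,1)^d)`. -/
def HasWeakDeriv {d : ℕ} (k : ℕ) (f : (Fin d → ℝ) → ℝ)
    (g : (Fin k → Fin d) → (Fin d → ℝ) → ℝ) : Prop :=
  (∀ α, LocallyIntegrableOn (g α) (openCube d)) ∧
  ∀ (α : Fin k → Fin d) (φ : (Fin d → ℝ) → ℝ), ContDiff ℝ ∞ φ → HasCompactSupport φ →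
    tsupport φ ⊆ openCube d →
    ∫ x in openCube d, f x * iteratedFDeriv ℝ k φ x (fun j => Pi.single (α j) (1 : ℝ)) =
      (-1) ^ k * ∫ x in openCube d, g α x * φ x

/-- `‖D^k f‖_{L²}` for `D^k f = g`: the `L²((0,1)^d)` norm of the Euclidean (Frobenius) length of the
tensor `D^k f` of all `k`-th order partial derivatives. -/
def derivL2Norm {d k : ℕ} (g : (Fin k → Fin d) → (Fin d → ℝ) → ℝ) : ℝ :=
  Real.sqrt (∑ α, ∫ x in openCube d, (g α x) ^ 2)

/-- The exponent `ϑ(k, d, q)`: it is `k / (2k + d)` if `q ≤ (4k + 2d) / d` and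
`(k - d/2 + d/q) / (2k)` otherwise (with `d/∞ = 0`). -/
def vartheta (k d : ℕ) (q : ℝ≥0∞) : ℝ :=
  if q ≤ ENNReal.ofReal ((4 * k + 2 * d) / d) then (k : ℝ) / (2 * k + d)
  else (k - (d : ℝ) / 2 + d * (q⁻¹).toReal) / (2 * k)

end MultiresolutionNorm

end

/-! Put `σ = ‖S_n f‖_𝓑 / √n` and `D = ‖D^k f‖_{L²}`, and let `ν` be the measure with density `|D^k
f|²`. The proof derives a local sup bound and then sums it over cubes chosen by a stopping rule.

Local bound (`exists_local_bound`): on a cube `Q` of side `h ≥ κ / N`, `|f| ≤ A (σ h^(-d/2) +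
h^(k-d/2) ν(Q)^(1/2))`. Since `k > d/2`, `f` differs from its tensor Lagrange interpolant with `k^d`
nodes by a multiple of the second term (`exists_interpolation_error_bound`). Let `M` be the largest
modulus of a nodal value. Near that node the interpolant moves by at most `M / 2`, and a cube `B` of
the normal system lies there with at least a constant times `(N h)^d` grid points. The mean of `f`
over the grid points of `B` is at most a constant times `σ h^(-d/2)`, so `M` can be absorbed.

Global bound: if `D ≤ σ`, the unit cube suffices. Otherwise replace `σ` by `s = max σ (D h₀^k)`,
where `h₀` is a constant over `N`. Halve cubes dyadically as long as `ν(Q) h^(2k) ≥ s²`; the choice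
of `s` stops this before the sides leave the range of the local bound. On a stopped cube `|f| ≤ 2 A
s h^(-d/2)`. For `p = (4k+2d)/d` its share of `∫ |f|^p` is at most `(2As)^p h^(-2k)`, and these
shares sum to a multiple of `s^(p-2) D²` (`lintegral_cube_le_of_local_bound`). A cube of side
`(s/D)^(1/k)` gives the sup bound; interpolating between `L^p` and `L^∞` covers `q ≥ p`, and
monotonicity of norms on a probability space covers `q ≤ p`. The result is a multiple of `s^(2ϑ)
D^(1-2ϑ)`; the two candidates for `s` produce the first and third terms of the maximum. -/

namespace MultiresolutionNorm

/-! ### Tensor product Lagrange interpolation -/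

/-- The equidistant node `r / k` of `[0,1)`. -/
noncomputable def node (k : ℕ) (r : Fin k) : ℝ := (r : ℕ) / (k : ℝ)

theorem node_injective (k : ℕ) : Function.Injective (node k) := by
  intro r s h
  have hk : (0 : ℝ) < k := by exact_mod_cast r.pos
  unfold node at h
  rw [div_left_inj' hk.ne'] at h
  exact Fin.ext (by exact_mod_cast h)

theorem node_nonneg (k : ℕ) (r : Fin k) : 0 ≤ node k r := by unfold node; positivity

theorem node_add_le_one (k : ℕ) (r : Fin k) : node k r + 1 / k ≤ 1 := by
  have hk : (0 : ℝ) < k := by exact_mod_cast r.pos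
  rw [node, ← add_div, div_le_one hk]
  exact_mod_cast r.isLt

/-- The point of the tensor product grid of nodes with index `i`. -/
noncomputable def nodePoint {d k : ℕ} (i : Fin d → Fin k) : Fin d → ℝ := fun m => node k (i m)

theorem nodePoint_mem {d k : ℕ} (i : Fin d → Fin k) : nodePoint i ∈ Set.Icc (0 : Fin d → ℝ) 1 := by
  refine ⟨fun m => node_nonneg k _, fun m => ?_⟩
  have h := node_add_le_one k (i m)
  have : (0 : ℝ) ≤ 1 / k := by positivity
  simp only [nodePoint, Pi.one_apply]
  linarith

/-- The tensor product Lagrange basis for the nodes `nodePoint i`. -/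
noncomputable def tensorLagrange {d k : ℕ} (i : Fin d → Fin k) (x : Fin d → ℝ) : ℝ :=
  ∏ m, (Lagrange.basis Finset.univ (node k) (i m)).eval (x m)

theorem continuous_tensorLagrange {d k : ℕ} (i : Fin d → Fin k) :
    Continuous (tensorLagrange i) := by
  unfold tensorLagrange
  refine continuous_finsetProd _ fun m _ => ?_
  exact (Polynomial.continuous _).comp (continuous_apply m)

theorem tensorLagrange_nodePoint {d k : ℕ} (i j : Fin d → Fin k) :
    tensorLagrange i (nodePoint j) = if i = j then 1 else 0 := by
  unfold tensorLagrange nodePoint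
  split_ifs with h
  · subst h
    exact Finset.prod_eq_one fun m _ =>
      Lagrange.eval_basis_self ((node_injective k).injOn) (Finset.mem_univ _)
  · obtain ⟨m, hm⟩ := Function.ne_iff.1 h
    exact Finset.prod_eq_zero (Finset.mem_univ m)
      (Lagrange.eval_basis_of_ne hm (Finset.mem_univ _))

theorem sum_lagrange_pow {k n : ℕ} (hn : n < k) (y t : ℝ) :
    ∑ r : Fin k, (node k r - y) ^ n * (Lagrange.basis Finset.univ (node k) r).eval t
      = (t - y) ^ n := by
  have h := Lagrange.eq_interpolate (s := Finset.univ) (v := node k)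
    (f := (Polynomial.X - Polynomial.C y) ^ n) ((node_injective k).injOn) (by
      rw [Polynomial.degree_pow, Polynomial.degree_X_sub_C]
      simpa using hn)
  have h2 := congrArg (Polynomial.eval t) h
  rw [Lagrange.interpolate_apply, Polynomial.eval_finsetSum] at h2
  simpa using h2.symm

theorem sum_tensorLagrange_prod_pow {d k : ℕ} (n : Fin d → ℕ) (hn : ∀ m, n m < k)
    (x y : Fin d → ℝ) :
    ∑ i : Fin d → Fin k, (∏ m, (nodePoint i m - y m) ^ n m) * tensorLagrange i x
      = ∏ m, (x m - y m) ^ n m := by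
  simp_rw [← fun m => sum_lagrange_pow (hn m) (y m) (x m)]
  rw [Finset.prod_univ_sum]
  simp only [Fintype.piFinset_univ, tensorLagrange, nodePoint, Finset.prod_mul_distrib]

/-- Grouping equal factors turns the product into a monomial of degree at most `j < k` in each
coordinate, so one-dimensional reproduction applies coordinatewise. Hence interpolation reproduces
Taylor polynomials of degree below `k`. -/
theorem sum_tensorLagrange_prod {d k j : ℕ} (hj : j < k) (α : Fin j → Fin d) (x y : Fin d → ℝ) :
    ∑ i : Fin d → Fin k, (∏ l, (nodePoint i (α l) - y (α l))) * tensorLagrange i x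
      = ∏ l, (x (α l) - y (α l)) := by
  classical
  have key : ∀ z : Fin d → ℝ, ∏ l, z (α l)
      = ∏ m, z m ^ (Finset.univ.filter (fun l => α l = m)).card := by
    intro z
    rw [← Finset.prod_fiberwise Finset.univ α]
    refine Finset.prod_congr rfl fun m _ => ?_
    rw [Finset.prod_congr rfl (fun l hl => by rw [(Finset.mem_filter.1 hl).2]),
      Finset.prod_const]
  have hn : ∀ m, (Finset.univ.filter (fun l => α l = m)).card < k := fun m =>
    lt_of_le_of_lt ((Finset.card_le_univ _).trans (by simp)) hj
  have := sum_tensorLagrange_prod_pow _ hn x y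
  rw [key (fun m => x m - y m), ← this]
  exact Finset.sum_congr rfl fun i _ => by rw [key (fun m => nodePoint i m - y m)]

theorem exists_tensorLagrange_bound (d k : ℕ) :
    ∃ K : ℝ, 0 ≤ K ∧ ∀ (i : Fin d → Fin k), ∀ x ∈ Set.Icc (0 : Fin d → ℝ) 1,
      |tensorLagrange i x| ≤ K := by
  have h : ∀ i : Fin d → Fin k, ∃ K : ℝ, ∀ x ∈ Set.Icc (0 : Fin d → ℝ) 1,
      |tensorLagrange i x| ≤ K := fun i => by
    obtain ⟨K, hK⟩ := isCompact_Icc.exists_bound_of_continuousOn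
      (continuous_tensorLagrange i).continuousOn
    exact ⟨K, hK⟩
  choose K hK using h
  refine ⟨∑ i, |K i|, Finset.sum_nonneg fun _ _ => abs_nonneg _, fun i x hx => ?_⟩
  exact (hK i x hx).trans ((le_abs_self _).trans
    (Finset.single_le_sum (f := fun i => |K i|) (fun _ _ => abs_nonneg _) (Finset.mem_univ i)))

/-- Controls how far an interpolant can drift from its value at a node, in terms of the largest
nodal value only. -/
theorem exists_tensorLagrange_modulus (d k : ℕ) (η : ℝ) (hη : 0 < η) :
    ∃ δ : ℝ, 0 < δ ∧ ∀ (i : Fin d → Fin k), ∀ x ∈ Set.Icc (0 : Fin d → ℝ) 1,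
      ∀ y ∈ Set.Icc (0 : Fin d → ℝ) 1, dist x y ≤ δ →
      |tensorLagrange i x - tensorLagrange i y| ≤ η := by
  have h : ∀ i : Fin d → Fin k, ∃ δ : ℝ, 0 < δ ∧ ∀ x ∈ Set.Icc (0 : Fin d → ℝ) 1,
      ∀ y ∈ Set.Icc (0 : Fin d → ℝ) 1, dist x y ≤ δ →
      |tensorLagrange i x - tensorLagrange i y| ≤ η := fun i => by
    have hu := (isCompact_Icc (a := (0 : Fin d → ℝ)) (b := 1)).uniformContinuousOn_of_continuous
      (continuous_tensorLagrange i).continuousOn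
    obtain ⟨δ, hδ, h⟩ := Metric.uniformContinuousOn_iff_le.1 hu η hη
    exact ⟨δ, hδ, h⟩
  choose δ hδ h using h
  rcases isEmpty_or_nonempty (Fin d → Fin k) with he | he
  · exact ⟨1, one_pos, fun i => (he.false i).elim⟩
  · refine ⟨Finset.univ.inf' Finset.univ_nonempty δ, ?_, fun i x hx y hy hxy => ?_⟩
    · rw [Finset.lt_inf'_iff]
      exact fun i _ => hδ i
    · exact h i x hx y hy (hxy.trans (Finset.inf'_le _ (Finset.mem_univ i)))

/-! ### Averaging the Taylor remainder over the base point -/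

theorem lintegral_comp_add_smul {d : ℕ} (H : (Fin d → ℝ) → ℝ≥0∞) (hH : Measurable H)
    (b : Fin d → ℝ) {s : ℝ} (hs : 0 < s) :
    ∫⁻ y, H (b + s • y) = ENNReal.ofReal (s ^ d)⁻¹ * ∫⁻ z, H z := by
  have h1 : ∫⁻ y, H (b + s • y) = ∫⁻ w, H (b + w) ∂(Measure.map (s • ·) volume) := by
    rw [lintegral_map (f := fun w => H (b + w)) (by fun_prop) (measurable_const_smul s)]
  rw [h1, Measure.map_addHaar_smul volume hs.ne', lintegral_smul_measure,
    lintegral_add_left_eq_self (μ := volume) H b, Module.finrank_fin_fun,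
    abs_of_nonneg (by positivity), smul_eq_mul]

theorem volume_Icc_zero_one (d : ℕ) : volume (Set.Icc (0 : Fin d → ℝ) 1) = 1 := by
  simp [Real.volume_Icc_pi]

/-- Hölder's inequality against the constant function one. -/
theorem lintegral_le_sqrt_lintegral_sq {α : Type*} [MeasurableSpace α] (μ : Measure α)
    (hμ : μ Set.univ ≤ 1) (H : α → ℝ≥0∞) (hH : AEMeasurable H μ) :
    ∫⁻ y, H y ∂μ ≤ (∫⁻ y, H y ^ 2 ∂μ) ^ (1 / 2 : ℝ) := by
  have h := ENNReal.lintegral_mul_le_Lp_mul_Lq μ Real.HolderConjugate.two_two hH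
    (aemeasurable_const (b := (1 : ℝ≥0∞)))
  simp only [Pi.mul_apply, mul_one, ENNReal.one_rpow, lintegral_const, one_mul] at h
  refine h.trans ?_
  have h2 : (μ Set.univ) ^ (1 / 2 : ℝ) ≤ 1 := by
    calc (μ Set.univ) ^ (1 / 2 : ℝ) ≤ 1 ^ (1 / 2 : ℝ) := by gcongr
      _ = 1 := by simp
  calc _ ≤ (∫⁻ y, H y ^ (2 : ℝ) ∂μ) ^ (1 / 2 : ℝ) * 1 := by gcongr
    _ = _ := by
      rw [mul_one]
      norm_cast

/-- The constant `∫₀¹ (1 - t)^(k - 1 - d / 2) dt`. -/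
noncomputable def kernelConst (k d : ℕ) : ℝ≥0∞ :=
  ∫⁻ t in Set.Ioo (0 : ℝ) 1,
    ENNReal.ofReal ((1 - t) ^ (k - 1)) * (ENNReal.ofReal ((1 - t) ^ d)⁻¹) ^ (1 / 2 : ℝ)

/-- The integrand is `(1 - t)^(k - 1 - d/2)`, whose exponent exceeds `-1` because `k > d/2`. -/
theorem kernelConst_lt_top (k d : ℕ) (hk : (d : ℝ) / 2 < k) : kernelConst k d < ⊤ := by
  have hk0 : 1 ≤ k := by
    have : (0 : ℝ) < k := lt_of_le_of_lt (by positivity) hk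
    exact_mod_cast this
  have h1 : IntervalIntegrable (fun t : ℝ => t ^ ((k : ℝ) - 1 - d / 2)) volume 0 1 :=
    intervalIntegral.intervalIntegrable_rpow' (by linarith)
  have h2 := (h1.comp_sub_left 1).symm
  simp only [sub_zero, sub_self] at h2
  rw [intervalIntegrable_iff_integrableOn_Ioo_of_le zero_le_one] at h2
  have h3 := h2.lintegral_lt_top
  refine lt_of_eq_of_lt ?_ h3
  unfold kernelConst
  refine setLIntegral_congr_fun measurableSet_Ioo fun t ht => ?_
  have hs : 0 < 1 - t := by linarith [ht.2]
  rw [ENNReal.ofReal_rpow_of_nonneg (by positivity) (by norm_num),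
    ← ENNReal.ofReal_mul (by positivity)]
  congr 1
  rw [← Real.rpow_natCast, ← Real.rpow_natCast, ← Real.rpow_neg hs.le, ← Real.rpow_mul hs.le,
    ← Real.rpow_add hs]
  congr 1
  push_cast [hk0]
  ring

/-- The average over `y` of the remainder term in Taylor's formula at `x`. -/
theorem lintegral_taylor_remainder_le (k d : ℕ) (H : (Fin d → ℝ) → ℝ≥0∞) (hH : Measurable H)
    (x : Fin d → ℝ) (hx : x ∈ Set.Icc (0 : Fin d → ℝ) 1) :
    ∫⁻ y in Set.Icc (0 : Fin d → ℝ) 1, ∫⁻ t in Set.Ioo (0 : ℝ) 1,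
        ENNReal.ofReal ((1 - t) ^ (k - 1)) * H (y + t • (x - y))
      ≤ kernelConst k d * (∫⁻ w in Set.Icc (0 : Fin d → ℝ) 1, H w ^ 2) ^ (1 / 2 : ℝ) := by
  -- For fixed `t`, Cauchy–Schwarz in `y` is followed by the substitution `w = t x + (1 - t) y`. It
  -- maps the unit cube into itself and has Jacobian `(1 - t)^d`, which accounts for the factor `(1
  -- - t)^(-d/2)` in `kernelConst`.
  rw [lintegral_lintegral_swap (by fun_prop), kernelConst, ← lintegral_mul_const _ (by fun_prop)]
  refine setLIntegral_mono' measurableSet_Ioo fun t ht => ?_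
  have hs : 0 < 1 - t := by linarith [ht.2]
  rw [lintegral_const_mul _ (by fun_prop), mul_assoc]
  gcongr
  rw [← ENNReal.mul_rpow_of_nonneg _ _ (by norm_num : (0 : ℝ) ≤ 1 / 2)]
  refine (lintegral_le_sqrt_lintegral_sq _ (by simp [volume_Icc_zero_one]) _
    (by fun_prop)).trans ?_
  gcongr
  have hm : MeasurableSet (Set.Icc (0 : Fin d → ℝ) 1) := measurableSet_Icc
  rw [← lintegral_indicator hm (fun w => H w ^ 2),
    ← lintegral_comp_add_smul _ (by exact (by fun_prop : Measurable fun w => H w ^ 2).indicator hm)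
      (t • x) hs, ← lintegral_indicator hm]
  refine lintegral_mono fun y => ?_
  by_cases hy : y ∈ Set.Icc (0 : Fin d → ℝ) 1
  · have e : y + t • (x - y) = t • x + (1 - t) • y := by
      rw [smul_sub, sub_smul, one_smul]; abel
    have hmem : t • x + (1 - t) • y ∈ Set.Icc (0 : Fin d → ℝ) 1 :=
      convex_Icc (0 : Fin d → ℝ) 1 hx hy ht.1.le hs.le (by ring)
    rw [Set.indicator_of_mem hy, Set.indicator_of_mem hmem, e]
  · rw [Set.indicator_of_notMem hy]
    exact zero_le

/-! ### Mollified functions: Taylor's formula and interpolation error -/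

/-- The mollification of `|g|` with the kernel `φ`, on the cube with corner `a` and side `h`
rescaled to the unit cube. -/
noncomputable def mollifiedAbs {d : ℕ} (φ g : (Fin d → ℝ) → ℝ) (a : Fin d → ℝ) (h : ℝ)
    (w : Fin d → ℝ) : ℝ≥0∞ :=
  ∫⁻ z in openCube d, ‖g z‖ₑ * ENNReal.ofReal (φ (z - (a + h • w)))

theorem measurable_mollifiedAbs {d : ℕ} {φ g : (Fin d → ℝ) → ℝ} (hφ : Measurable φ)
    (hg : Measurable g) (a : Fin d → ℝ) (h : ℝ) : Measurable (mollifiedAbs φ g a h) := by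
  unfold mollifiedAbs
  exact Measurable.lintegral_prod_right'
    (f := fun p : (Fin d → ℝ) × (Fin d → ℝ) =>
      ‖g p.2‖ₑ * ENNReal.ofReal (φ (p.2 - (a + h • p.1)))) (by fun_prop)

/-- Jensen's inequality for the translated kernel moves the square onto `g`. After Fubini, the
integral of the kernel over `w` is at most `h^(-d)`, by scaling. The support condition keeps the
right side local to `Q`. -/
theorem lintegral_mollifiedAbs_sq_le {d : ℕ} {φ g : (Fin d → ℝ) → ℝ} (hφ : Measurable φ)
    (hφ1 : ∫⁻ z, ENNReal.ofReal (φ z) = 1) (hg : Measurable g) (a : Fin d → ℝ) {h : ℝ}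
    (hh : 0 < h) (Q : Set (Fin d → ℝ)) (hQ : MeasurableSet Q)
    (hsupp : ∀ w ∈ Set.Icc (0 : Fin d → ℝ) 1, ∀ z ∉ Q, φ (z - (a + h • w)) = 0) :
    ∫⁻ w in Set.Icc (0 : Fin d → ℝ) 1, mollifiedAbs φ g a h w ^ 2
      ≤ ENNReal.ofReal (h ^ d)⁻¹ * ∫⁻ z in Q, ‖g z‖ₑ ^ 2 ∂(volume.restrict (openCube d)) := by
  have step : ∀ w ∈ Set.Icc (0 : Fin d → ℝ) 1, mollifiedAbs φ g a h w ^ 2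
      ≤ ∫⁻ z in Q, ‖g z‖ₑ ^ 2 * ENNReal.ofReal (φ (z - (a + h • w)))
        ∂(volume.restrict (openCube d)) := by
    intro w hw
    have hmd : Measurable fun z : Fin d → ℝ => ENNReal.ofReal (φ (z - (a + h • w))) := by
      fun_prop
    set μ := ((volume.restrict (openCube d)).restrict Q).withDensity
      (fun z => ENNReal.ofReal (φ (z - (a + h • w)))) with hμ
    have e : ∀ G : (Fin d → ℝ) → ℝ≥0∞, Measurable G → ∫⁻ z, G z ∂μ
        = ∫⁻ z in Q, G z * ENNReal.ofReal (φ (z - (a + h • w)))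
          ∂(volume.restrict (openCube d)) := by
      intro G hG
      rw [hμ, lintegral_withDensity_eq_lintegral_mul _ hmd hG]
      simp [mul_comm]
    have hmass : μ Set.univ ≤ 1 := by
      rw [hμ, withDensity_apply _ MeasurableSet.univ, Measure.restrict_univ, ← hφ1,
        ← lintegral_sub_right_eq_self (μ := volume) (fun z => ENNReal.ofReal (φ z)) (a + h • w)]
      exact lintegral_mono' (Measure.restrict_le_self.trans Measure.restrict_le_self) le_rfl
    have h1 := lintegral_le_sqrt_lintegral_sq μ hmass (fun z => ‖g z‖ₑ) (by fun_prop)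
    rw [e _ (by fun_prop), e _ (by fun_prop)] at h1
    have h2 : mollifiedAbs φ g a h w = ∫⁻ z in Q, ‖g z‖ₑ * ENNReal.ofReal (φ (z - (a + h • w)))
        ∂(volume.restrict (openCube d)) := by
      rw [← lintegral_indicator hQ, mollifiedAbs]
      refine lintegral_congr fun z => ?_
      by_cases hz : z ∈ Q
      · rw [Set.indicator_of_mem hz]
      · rw [Set.indicator_of_notMem hz, hsupp w hw z hz]; simp
    rw [h2]
    refine (pow_le_pow_left' h1 2).trans_eq ?_
    rw [← ENNReal.rpow_natCast, ← ENNReal.rpow_mul]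
    norm_num
  refine (setLIntegral_mono' measurableSet_Icc step).trans ?_
  rw [lintegral_lintegral_swap (by fun_prop), ← lintegral_const_mul _ (by fun_prop)]
  refine lintegral_mono fun z => ?_
  simp only
  rw [lintegral_const_mul _ (by fun_prop), mul_comm]
  gcongr
  refine (setLIntegral_le_lintegral _ _).trans ?_
  have h3 := lintegral_comp_add_smul (fun w => ENNReal.ofReal (φ (z - a - w))) (by fun_prop) 0 hh
  have h4 := lintegral_sub_left_eq_self (μ := volume) (fun w => ENNReal.ofReal (φ w)) (z - a)
  rw [h4, hφ1, mul_one] at h3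
  rw [← h3]
  exact le_of_eq (lintegral_congr fun w => by rw [zero_add, sub_sub])

/-- Rewrites the directional derivatives of Taylor's formula as the partial derivatives to which the
weak formulation applies. -/
theorem multilinear_apply_const {d j : ℕ}
    (M : ContinuousMultilinearMap ℝ (fun _ : Fin j => Fin d → ℝ) ℝ) (v : Fin d → ℝ) :
    M (fun _ => v) = ∑ α : Fin j → Fin d,
      (∏ l, v (α l)) * M (fun l => Pi.single (α l) (1 : ℝ)) := by
  have hv : v = ∑ i, v i • Pi.single i (1 : ℝ) := by
    ext m
    simp [Finset.sum_apply, Pi.single_apply]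
  conv_lhs => rw [show (fun _ : Fin j => v)
    = fun _ : Fin j => ∑ i, v i • (Pi.single i (1 : ℝ) : Fin d → ℝ) from funext fun _ => hv]
  rw [M.map_sum]
  refine Finset.sum_congr rfl fun α _ => ?_
  rw [M.map_smul_univ, smul_eq_mul]

theorem exists_bound_iteratedFDeriv_apply {d : ℕ} {φ : (Fin d → ℝ) → ℝ} (hφ : ContDiff ℝ ∞ φ)
    (hc : HasCompactSupport φ) (j : ℕ) (v : Fin d → ℝ) :
    ∃ C, ∀ z, ‖iteratedFDeriv ℝ j φ z (fun _ => v)‖ ≤ C := by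
  obtain ⟨C, hC⟩ := (hc.iteratedFDeriv (𝕜 := ℝ) j).exists_bound_of_continuous
    (hφ.continuous_iteratedFDeriv (by exact_mod_cast le_top))
  refine ⟨C * ∏ _l : Fin j, ‖v‖, fun z => ((iteratedFDeriv ℝ j φ z).le_opNorm _).trans ?_⟩
  gcongr
  exact hC z

theorem measurableSet_openCube {d : ℕ} : MeasurableSet (openCube d) :=
  MeasurableSet.univ_pi fun _ => measurableSet_Ioo

/-- The mollification of `f` with the kernel `φ`, on the cube with corner `a` and side `h`
rescaled to the unit cube. -/
noncomputable def mollified {d : ℕ} (φ f : (Fin d → ℝ) → ℝ) (a : Fin d → ℝ) (h : ℝ)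
    (w : Fin d → ℝ) : ℝ :=
  ∫ z in openCube d, f z * φ (z - (a + h • w))

/-- Taylor's formula for a mollified function, with the remainder bounded in terms of the
mollified weak derivatives. -/
theorem exists_taylor_mollified {d k : ℕ} (hk : 0 < k) {φ f : (Fin d → ℝ) → ℝ}
    {g : (Fin k → Fin d) → (Fin d → ℝ) → ℝ}
    (hφ : ContDiff ℝ ∞ φ) (hc : HasCompactSupport φ) (hφ0 : ∀ z, 0 ≤ φ z)
    (hf : IntegrableOn f (openCube d)) (hg : ∀ α, Measurable (g α)) (a : Fin d → ℝ) {h : ℝ} (hh : 0 < h)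
    (hweak : ∀ α, ∀ w ∈ Set.Icc (0 : Fin d → ℝ) 1,
      ∫ z in openCube d, f z * iteratedFDeriv ℝ k φ (z - (a + h • w))
          (fun l => Pi.single (α l) (1 : ℝ))
        = (-1) ^ k * ∫ z in openCube d, g α z * φ (z - (a + h • w)))
    (y : Fin d → ℝ) (hy : y ∈ Set.Icc (0 : Fin d → ℝ) 1) :
    ∃ c : (j : ℕ) → (Fin j → Fin d) → ℝ, ∀ x ∈ Set.Icc (0 : Fin d → ℝ) 1,
      ‖mollified φ f a h x
          - ∑ j ∈ Finset.range k, ∑ α, c j α * ∏ l, (x (α l) - y (α l))‖ₑ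
        ≤ ENNReal.ofReal (h ^ k) * ∑ α, ∫⁻ t in Set.Ioo (0 : ℝ) 1,
            ENNReal.ofReal ((1 - t) ^ (k - 1)) * mollifiedAbs φ (g α) a h (y + t • (x - y)) := by
  obtain ⟨n, rfl⟩ : ∃ n, k = n + 1 := ⟨k - 1, by omega⟩
  set u : Fin d → ℝ := a + h • y with hu
  have hcont : ∀ j (m : Fin j → Fin d → ℝ), Continuous fun z => iteratedFDeriv ℝ j φ z m :=
    fun j m => (hφ.continuous_iteratedFDeriv
      (by exact_mod_cast le_top)).eval continuous_const
  have hint : ∀ j (v p : Fin d → ℝ),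
      IntegrableOn (fun z => f z * iteratedFDeriv ℝ j φ (z - p) (fun _ => v)) (openCube d) := by
    intro j v p
    obtain ⟨C, hC⟩ := exists_bound_iteratedFDeriv_apply hφ hc j v
    exact hf.mul_bdd (c := C) ((hcont j _).comp (continuous_sub_right p)).aestronglyMeasurable
      (Filter.Eventually.of_forall fun z => hC _)
  have hint' : ∀ j (m : Fin j → Fin d → ℝ) (p : Fin d → ℝ),
      IntegrableOn (fun z => f z * iteratedFDeriv ℝ j φ (z - p) m) (openCube d) := by
    intro j m p
    obtain ⟨C, hC⟩ := (hc.iteratedFDeriv (𝕜 := ℝ) j).exists_bound_of_continuous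
      (hφ.continuous_iteratedFDeriv (by exact_mod_cast le_top))
    refine hf.mul_bdd (c := C * ∏ l, ‖m l‖)
      ((hcont j _).comp (continuous_sub_right p)).aestronglyMeasurable
      (Filter.Eventually.of_forall fun z => ((iteratedFDeriv ℝ j φ _).le_opNorm _).trans ?_)
    gcongr
    exact hC _
  refine ⟨fun j α => (j.factorial : ℝ)⁻¹ * ((-h) ^ j *
    ∫ z in openCube d, f z * iteratedFDeriv ℝ j φ (z - u) (fun l => Pi.single (α l) (1 : ℝ))),
    fun x hx => ?_⟩
  set v : Fin d → ℝ := -(h • (x - y)) with hv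
  -- Taylor's formula is applied to the smooth kernel, not to `f`: moving the evaluation point from
  -- `y` to `x` shifts the argument of `φ` by `v = -h (x - y)`.
  have hpoint : ∀ z, f z * φ (z - (a + h • x))
      = (∑ j ∈ Finset.range (n + 1), (j.factorial : ℝ)⁻¹ *
          (f z * iteratedFDeriv ℝ j φ (z - u) (fun _ => v)))
        + (n.factorial : ℝ)⁻¹ * ∫ t in (0 : ℝ)..1,
          (1 - t) ^ n * (f z * iteratedFDeriv ℝ (n + 1) φ (z - u + t • v) (fun _ => v)) := by
    intro z
    have e : z - (a + h • x) = (z - u) + v := by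
      rw [hu, hv, smul_sub]; abel
    have hT := map_add_eq_sum_add_integral_iteratedFDeriv (f := φ) (x := z - u) (y := v) (n := n)
      (fun t _ => (hφ.of_le (by exact_mod_cast le_top)).contDiffAt)
    rw [e, hT, mul_add, Finset.mul_sum]
    congr 1
    · exact Finset.sum_congr rfl fun j _ => by rw [smul_eq_mul]; ring
    · rw [smul_eq_mul, mul_left_comm, ← intervalIntegral.integral_const_mul]
      congr 1
      exact intervalIntegral.integral_congr fun t _ => by simp only [smul_eq_mul]; ring
  -- Fubini for the remainder
  have hprod : Integrable (fun p : (Fin d → ℝ) × ℝ =>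
      (1 - p.2) ^ n * (f p.1 * iteratedFDeriv ℝ (n + 1) φ (p.1 - u + p.2 • v) (fun _ => v)))
      ((volume.restrict (openCube d)).prod (volume.restrict (Set.Ioc (0 : ℝ) 1))) := by
    obtain ⟨C, hC⟩ := exists_bound_iteratedFDeriv_apply hφ hc (n + 1) v
    have hC0 : 0 ≤ C := (norm_nonneg _).trans (hC 0)
    have h1 : Integrable (fun p : (Fin d → ℝ) × ℝ => f p.1)
      ((volume.restrict (openCube d)).prod (volume.restrict (Set.Ioc (0 : ℝ) 1))) :=
      Integrable.comp_fst hf _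
    have h2 : Continuous fun p : (Fin d → ℝ) × ℝ =>
        (1 - p.2) ^ n * iteratedFDeriv ℝ (n + 1) φ (p.1 - u + p.2 • v) (fun _ => v) :=
      ((continuous_const.sub continuous_snd).pow n).mul
        ((hcont (n + 1) _).comp (by fun_prop))
    have h3 := h1.mul_bdd (c := C) h2.aestronglyMeasurable (by
      rw [Measure.prod_restrict]
      refine ae_restrict_of_forall_mem (measurableSet_openCube.prod measurableSet_Ioc)
        fun p hp => ?_
      rw [norm_mul]
      have hp' : p.2 ∈ Set.Ioc (0 : ℝ) 1 := hp.2
      have : ‖(1 - p.2) ^ n‖ ≤ 1 := by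
        rw [norm_pow]
        refine pow_le_one₀ (norm_nonneg _) ?_
        rw [Real.norm_eq_abs, abs_le]
        constructor <;> linarith [hp'.1, hp'.2]
      calc _ ≤ 1 * C := mul_le_mul this (hC _) (norm_nonneg _) zero_le_one
        _ = C := one_mul C)
    refine h3.congr (Filter.Eventually.of_forall fun p => ?_)
    simp only
    ring
  have hswap : ∫ z in openCube d, ∫ t in (0 : ℝ)..1,
        (1 - t) ^ n * (f z * iteratedFDeriv ℝ (n + 1) φ (z - u + t • v) (fun _ => v))
      = ∫ t in Set.Ioc (0 : ℝ) 1, ∫ z in openCube d,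
        (1 - t) ^ n * (f z * iteratedFDeriv ℝ (n + 1) φ (z - u + t • v) (fun _ => v)) := by
    simp_rw [intervalIntegral.integral_of_le zero_le_one]
    exact integral_integral_swap hprod
  have hremint : Integrable (fun z => ∫ t in (0 : ℝ)..1,
      (1 - t) ^ n * (f z * iteratedFDeriv ℝ (n + 1) φ (z - u + t • v) (fun _ => v)))
      (volume.restrict (openCube d)) := by
    simp_rw [intervalIntegral.integral_of_le zero_le_one]
    exact hprod.integral_prod_left
  have hF : mollified φ f a h x
      - ∑ j ∈ Finset.range (n + 1), ∑ α : Fin j → Fin d, ((j.factorial : ℝ)⁻¹ * ((-h) ^ j *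
        ∫ z in openCube d, f z * iteratedFDeriv ℝ j φ (z - u) (fun l => Pi.single (α l) (1 : ℝ))))
        * ∏ l, (x (α l) - y (α l))
      = (n.factorial : ℝ)⁻¹ * ∫ t in Set.Ioc (0 : ℝ) 1, ∫ z in openCube d,
        (1 - t) ^ n * (f z * iteratedFDeriv ℝ (n + 1) φ (z - u + t • v) (fun _ => v)) := by
    rw [← hswap, mollified, sub_eq_iff_eq_add, integral_congr_ae (Filter.Eventually.of_forall hpoint),
      integral_add (integrable_finsetSum _ fun j _ => (hint j v u).const_mul _)
        (hremint.const_mul _), integral_const_mul, add_comm]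
    congr 1
    rw [integral_finsetSum _ fun j _ => (hint j v u).const_mul _]
    refine Finset.sum_congr rfl fun j _ => ?_
    rw [integral_const_mul]
    simp_rw [multilinear_apply_const _ v, Finset.mul_sum]
    rw [integral_finsetSum _ fun α _ => ?_, Finset.mul_sum]
    · refine Finset.sum_congr rfl fun α _ => ?_
      have e : ∏ l, v (α l) = (-h) ^ j * ∏ l, (x (α l) - y (α l)) := by
        rw [← Fin.prod_const, ← Finset.prod_mul_distrib]
        exact Finset.prod_congr rfl fun l _ => by simp [hv]
      simp_rw [e, mul_left_comm (f _)]
      rw [integral_const_mul]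
      ring
    · simp_rw [mul_left_comm (f _)]
      exact (hint' j _ u).const_mul _
  rw [hF]
  have hfact : ‖(n.factorial : ℝ)⁻¹‖ₑ ≤ 1 := by
    rw [← ofReal_norm, ENNReal.ofReal_le_one, norm_inv, Real.norm_natCast]
    exact inv_le_one_of_one_le₀ (by exact_mod_cast n.factorial_pos)
  rw [enorm_mul]
  refine (mul_le_mul_left hfact _).trans ?_
  rw [one_mul]
  refine (enorm_integral_le_lintegral_enorm _).trans ?_
  rw [← restrict_Ioo_eq_restrict_Ioc]
  have hmain : ∀ t ∈ Set.Ioo (0 : ℝ) 1, ‖∫ z in openCube d,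
        (1 - t) ^ n * (f z * iteratedFDeriv ℝ (n + 1) φ (z - u + t • v) (fun _ => v))‖ₑ
      ≤ ∑ α, ENNReal.ofReal (h ^ (n + 1)) * (ENNReal.ofReal ((1 - t) ^ n) *
        mollifiedAbs φ (g α) a h (y + t • (x - y))) := by
    intro t ht
    have hw : y + t • (x - y) ∈ Set.Icc (0 : Fin d → ℝ) 1 :=
      (convex_Icc (0 : Fin d → ℝ) 1).add_smul_sub_mem hy hx ⟨ht.1.le, ht.2.le⟩
    have ez : ∀ z, z - u + t • v = z - (a + h • (y + t • (x - y))) := by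
      intro z
      rw [hu, hv, smul_add, smul_neg, smul_comm t h]; abel
    -- All `k` derivatives pass from the kernel to `g`. The kernel is centred at a point of the
    -- segment from `y` to `x`, which stays in the unit cube, so `hweak` is available there.
    have e2 : ∫ z in openCube d,
        f z * iteratedFDeriv ℝ (n + 1) φ (z - u + t • v) (fun _ => v)
        = ∑ α : Fin (n + 1) → Fin d, (∏ l, v (α l)) * ((-1) ^ (n + 1) *
          ∫ z in openCube d, g α z * φ (z - (a + h • (y + t • (x - y))))) := by
      simp_rw [ez, multilinear_apply_const _ v, Finset.mul_sum, mul_left_comm (f _)]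
      rw [integral_finsetSum _ fun α _ => (hint' _ _ _).const_mul _]
      exact Finset.sum_congr rfl fun α _ => by rw [integral_const_mul, hweak α _ hw]
    rw [integral_const_mul, e2, enorm_mul]
    rw [← Finset.mul_sum, ← Finset.mul_sum, mul_left_comm]
    have e3 : ‖(1 - t) ^ n‖ₑ = ENNReal.ofReal ((1 - t) ^ n) :=
      Real.enorm_of_nonneg (pow_nonneg (by linarith [ht.2]) _)
    rw [e3]
    gcongr
    rw [Finset.mul_sum]
    refine (enorm_sum_le _ _).trans (Finset.sum_le_sum fun α _ => ?_)
    rw [enorm_mul, enorm_mul]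
    have e4 : ‖((-1 : ℝ)) ^ (n + 1)‖ₑ = 1 := by simp [enorm_pow]
    rw [e4, one_mul]
    gcongr
    · rw [← ofReal_norm, norm_prod]
      gcongr
      rw [← Fin.prod_const]
      refine Finset.prod_le_prod (fun _ _ => norm_nonneg _) fun l _ => ?_
      rw [hv, Pi.neg_apply, norm_neg, Pi.smul_apply, smul_eq_mul, norm_mul,
        Real.norm_of_nonneg hh.le]
      refine mul_le_of_le_one_right hh.le ?_
      rw [Pi.sub_apply, Real.norm_eq_abs, abs_le]
      have a1 := hx.1 (α l); have a2 := hx.2 (α l)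
      have a3 := hy.1 (α l); have a4 := hy.2 (α l)
      simp only [Pi.zero_apply, Pi.one_apply] at a1 a2 a3 a4
      constructor <;> linarith
    · refine (enorm_integral_le_lintegral_enorm _).trans (lintegral_mono fun z => ?_)
      rw [enorm_mul, Real.enorm_of_nonneg (hφ0 _)]
  refine (setLIntegral_mono' measurableSet_Ioo hmain).trans ?_
  have hφm : Measurable φ := hφ.continuous.measurable
  have hmeas : ∀ α, Measurable fun t : ℝ => ENNReal.ofReal ((1 - t) ^ n) *
      mollifiedAbs φ (g α) a h (y + t • (x - y)) := fun α =>
    (by fun_prop : Measurable fun t : ℝ => ENNReal.ofReal ((1 - t) ^ n)).mul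
      ((measurable_mollifiedAbs hφm (hg α) a h).comp (by fun_prop))
  rw [lintegral_finsetSum _ fun α _ => (hmeas α).const_mul _, Finset.mul_sum]
  exact le_of_eq (Finset.sum_congr rfl fun α _ => lintegral_const_mul _ (hmeas α))

/-- The tensor product Lagrange interpolation error of a mollified function. -/
theorem mollified_interpolation_error {d k : ℕ} (hk : 0 < k) {φ f : (Fin d → ℝ) → ℝ}
    {g : (Fin k → Fin d) → (Fin d → ℝ) → ℝ}
    (hφ : ContDiff ℝ ∞ φ) (hc : HasCompactSupport φ) (hφ0 : ∀ z, 0 ≤ φ z)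
    (hφ1 : ∫⁻ z, ENNReal.ofReal (φ z) = 1)
    (hf : IntegrableOn f (openCube d)) (hg : ∀ α, Measurable (g α)) (a : Fin d → ℝ) {h : ℝ}
    (hh : 0 < h)
    (hweak : ∀ α, ∀ w ∈ Set.Icc (0 : Fin d → ℝ) 1,
      ∫ z in openCube d, f z * iteratedFDeriv ℝ k φ (z - (a + h • w))
          (fun l => Pi.single (α l) (1 : ℝ))
        = (-1) ^ k * ∫ z in openCube d, g α z * φ (z - (a + h • w)))
    (Q : Set (Fin d → ℝ)) (hQ : MeasurableSet Q)
    (hsupp : ∀ w ∈ Set.Icc (0 : Fin d → ℝ) 1, ∀ z ∉ Q, φ (z - (a + h • w)) = 0)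
    {K : ℝ} (hK : ∀ (i : Fin d → Fin k), ∀ x ∈ Set.Icc (0 : Fin d → ℝ) 1,
      |tensorLagrange i x| ≤ K)
    (x : Fin d → ℝ) (hx : x ∈ Set.Icc (0 : Fin d → ℝ) 1) :
    ‖mollified φ f a h x
        - ∑ i : Fin d → Fin k, tensorLagrange i x * mollified φ f a h (nodePoint i)‖ₑ
      ≤ (1 + (k : ℝ≥0∞) ^ d * ENNReal.ofReal K) * (kernelConst k d *
        (ENNReal.ofReal (h ^ ((k : ℝ) - d / 2)) *
          ∑ α, (∫⁻ z in Q, ‖g α z‖ₑ ^ 2 ∂(volume.restrict (openCube d))) ^ (1 / 2 : ℝ))) := by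
  set T : ℝ≥0∞ := kernelConst k d * (ENNReal.ofReal (h ^ ((k : ℝ) - d / 2)) *
    ∑ α, (∫⁻ z in Q, ‖g α z‖ₑ ^ 2 ∂(volume.restrict (openCube d))) ^ (1 / 2 : ℝ)) with hT
  have hφm : Measurable φ := hφ.continuous.measurable
  have hGm : ∀ α, Measurable (mollifiedAbs φ (g α) a h) := fun α =>
    measurable_mollifiedAbs hφm (hg α) a h
  let B : (Fin d → ℝ) → (Fin d → ℝ) → ℝ≥0∞ := fun x y =>
    ENNReal.ofReal (h ^ k) * ∑ α, ∫⁻ t in Set.Ioo (0 : ℝ) 1,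
      ENNReal.ofReal ((1 - t) ^ (k - 1)) * mollifiedAbs φ (g α) a h (y + t • (x - y))
  have hBm' : ∀ (x : Fin d → ℝ) α, Measurable fun y => ∫⁻ t in Set.Ioo (0 : ℝ) 1,
      ENNReal.ofReal ((1 - t) ^ (k - 1)) * mollifiedAbs φ (g α) a h (y + t • (x - y)) := by
    intro x α
    refine Measurable.lintegral_prod_right' (f := fun p : (Fin d → ℝ) × ℝ =>
      ENNReal.ofReal ((1 - p.2) ^ (k - 1)) * mollifiedAbs φ (g α) a h (p.1 + p.2 • (x - p.1))) ?_
    exact (by fun_prop : Measurable fun p : (Fin d → ℝ) × ℝ =>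
      ENNReal.ofReal ((1 - p.2) ^ (k - 1))).mul ((hGm α).comp (by fun_prop))
  have hBm : ∀ x, Measurable (B x) := fun x =>
    (Finset.measurable_sum _ fun α _ => hBm' x α).const_mul _
  have hBT : ∀ x ∈ Set.Icc (0 : Fin d → ℝ) 1,
      ∫⁻ y in Set.Icc (0 : Fin d → ℝ) 1, B x y ≤ T := by
    intro x hx
    simp only [B]
    rw [lintegral_const_mul _ (Finset.measurable_sum _ fun α _ => hBm' x α),
      lintegral_finsetSum _ fun α _ => hBm' x α]
    have e1 : ENNReal.ofReal (h ^ ((k : ℝ) - d / 2))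
        = ENNReal.ofReal (h ^ k) * (ENNReal.ofReal (h ^ d)⁻¹) ^ (1 / 2 : ℝ) := by
      rw [ENNReal.ofReal_rpow_of_nonneg (by positivity) (by norm_num),
        ← ENNReal.ofReal_mul (by positivity)]
      congr 1
      rw [← Real.rpow_natCast, ← Real.rpow_natCast, ← Real.rpow_neg hh.le, ← Real.rpow_mul hh.le,
        ← Real.rpow_add hh]
      congr 1
      ring
    rw [hT, e1, mul_assoc, mul_left_comm]
    gcongr
    rw [Finset.mul_sum, Finset.mul_sum]
    refine Finset.sum_le_sum fun α _ => ?_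
    refine (lintegral_taylor_remainder_le k d _ (hGm α) x hx).trans ?_
    gcongr
    rw [← ENNReal.mul_rpow_of_nonneg _ _ (by norm_num : (0 : ℝ) ≤ 1 / 2)]
    gcongr
    exact lintegral_mollifiedAbs_sq_le hφm hφ1 (hg α) a hh Q hQ hsupp
  have hy : ∀ y ∈ Set.Icc (0 : Fin d → ℝ) 1,
      ‖mollified φ f a h x
        - ∑ i : Fin d → Fin k, tensorLagrange i x * mollified φ f a h (nodePoint i)‖ₑ
      ≤ B x y + ∑ i : Fin d → Fin k, ENNReal.ofReal K * B (nodePoint i) y := by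
    intro y hy
    obtain ⟨c, hcT⟩ := exists_taylor_mollified hk hφ hc hφ0 hf hg a hh hweak y hy
    set P : (Fin d → ℝ) → ℝ := fun x =>
      ∑ j ∈ Finset.range k, ∑ α, c j α * ∏ l, (x (α l) - y (α l)) with hP
    -- The Taylor polynomial at `y` is reproduced exactly, so only the remainders at `x` and at the
    -- nodes survive.
    have hPx : P x = ∑ i : Fin d → Fin k, tensorLagrange i x * P (nodePoint i) := by
      simp only [hP, Finset.mul_sum]
      rw [Finset.sum_comm]
      refine Finset.sum_congr rfl fun j hj => ?_
      rw [Finset.sum_comm]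
      refine Finset.sum_congr rfl fun α _ => ?_
      rw [← sum_tensorLagrange_prod (Finset.mem_range.1 hj) α x y, Finset.mul_sum]
      exact Finset.sum_congr rfl fun i _ => by ring
    have e : mollified φ f a h x
        - ∑ i : Fin d → Fin k, tensorLagrange i x * mollified φ f a h (nodePoint i)
        = (mollified φ f a h x - P x) - ∑ i : Fin d → Fin k,
          tensorLagrange i x * (mollified φ f a h (nodePoint i) - P (nodePoint i)) := by
      simp only [mul_sub, Finset.sum_sub_distrib]
      rw [← hPx]; ring
    rw [e]
    refine enorm_sub_le.trans (add_le_add (hcT x hx) ?_)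
    refine (enorm_sum_le _ _).trans (Finset.sum_le_sum fun i _ => ?_)
    rw [enorm_mul]
    refine mul_le_mul' ?_ (hcT _ (nodePoint_mem i))
    rw [← ofReal_norm]
    exact ENNReal.ofReal_le_ofReal (hK i x hx)
  -- The left side does not depend on `y`, so integrating over a set of measure one leaves it intact
  -- while the remainders are averaged.
  have hfin := setLIntegral_mono' (μ := volume) measurableSet_Icc hy
  rw [setLIntegral_const, volume_Icc_zero_one, mul_one,
    lintegral_add_left (hBm x), lintegral_finsetSum _ fun i _ => (hBm _).const_mul _] at hfin
  refine hfin.trans ?_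
  rw [add_mul, one_mul]
  refine add_le_add (hBT x hx) ?_
  calc _ ≤ ∑ _i : Fin d → Fin k, ENNReal.ofReal K * T := by
        refine Finset.sum_le_sum fun i _ => ?_
        rw [lintegral_const_mul _ (hBm _)]
        gcongr
        exact hBT _ (nodePoint_mem i)
    _ = _ := by
      rw [Finset.sum_const, Finset.card_univ, nsmul_eq_mul]
      simp [mul_assoc]

/-! ### Removing the mollification -/

/-- The half-open cube with corner `a` and side `h`. -/
def cube {d : ℕ} (a : Fin d → ℝ) (h : ℝ) : Set (Fin d → ℝ) :=
  Set.univ.pi fun i => Set.Ico (a i) (a i + h)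

theorem measurableSet_cube {d : ℕ} (a : Fin d → ℝ) (h : ℝ) : MeasurableSet (cube a h) :=
  MeasurableSet.univ_pi fun _ => measurableSet_Ico

theorem openCube_subset_Icc (d : ℕ) : openCube d ⊆ Set.Icc 0 1 := fun _ hx =>
  ⟨fun i => (hx i trivial).1.le, fun i => (hx i trivial).2.le⟩

/-- `f` is approximated by its mollifications on slightly shrunken cubes. -/
theorem exists_mollifier {d k : ℕ} {f : (Fin d → ℝ) → ℝ}
    {g : (Fin k → Fin d) → (Fin d → ℝ) → ℝ} (hf : ContinuousOn f (Set.Icc 0 1))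
    (hw : HasWeakDeriv k f g) (a : Fin d → ℝ) {h : ℝ} (hh : 0 < h)
    (ha0 : ∀ i, 0 ≤ a i) (ha1 : ∀ i, a i + h ≤ 1) {η : ℝ} (hη : 0 < η) :
    ∃ (φ : (Fin d → ℝ) → ℝ) (b : Fin d → ℝ) (s : ℝ), ContDiff ℝ ∞ φ ∧ HasCompactSupport φ ∧
      (∀ z, 0 ≤ φ z) ∧ ∫⁻ z, ENNReal.ofReal (φ z) = 1 ∧ 0 < s ∧ s ≤ h ∧
      (∀ α, ∀ w ∈ Set.Icc (0 : Fin d → ℝ) 1,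
        ∫ z in openCube d, f z * iteratedFDeriv ℝ k φ (z - (b + s • w))
          (fun l => Pi.single (α l) (1 : ℝ))
        = (-1) ^ k * ∫ z in openCube d, g α z * φ (z - (b + s • w))) ∧
      (∀ w ∈ Set.Icc (0 : Fin d → ℝ) 1, ∀ z ∉ cube a h, φ (z - (b + s • w)) = 0) ∧
      ∀ x ∈ Set.Icc (0 : Fin d → ℝ) 1, |mollified φ f b s x - f (a + h • x)| ≤ η := by
  have hu := (isCompact_Icc (a := (0 : Fin d → ℝ)) (b := 1)).uniformContinuousOn_of_continuous hf
  obtain ⟨δ, hδ, hfδ⟩ := Metric.uniformContinuousOn_iff_le.1 hu η hη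
  -- With corner shifted by `2ε` and side reduced by `4ε`, kernels of radius `ε` stay inside `cube a
  -- h`; `8ε ≤ h` keeps the side positive. A point of the support of the kernel centred at `b + s x`
  -- lies within `ε + 2ε` of `a + h x`, whence `3ε ≤ δ`.
  obtain ⟨ε, hε, hεδ, hεh⟩ : ∃ ε : ℝ, 0 < ε ∧ 3 * ε ≤ δ ∧ 8 * ε ≤ h :=
    ⟨min (δ / 3) (h / 8), by positivity, by linarith [min_le_left (δ / 3) (h / 8)],
      by linarith [min_le_right (δ / 3) (h / 8)]⟩
  let bump : ContDiffBump (0 : Fin d → ℝ) := ⟨ε / 2, ε, by positivity, by linarith⟩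
  set φ := bump.normed volume with hφdef
  have hφc : ContDiff ℝ ∞ φ := bump.contDiff_normed
  have hφ0 : ∀ z, 0 ≤ φ z := bump.nonneg_normed
  have hφ1 : ∫ z, φ z = 1 := bump.integral_normed
  have hzero : ∀ z, φ z ≠ 0 → ∀ i, |z i| ≤ ε := by
    intro z hz i
    have h1 : z ∈ Function.support φ := hz
    rw [hφdef, bump.support_normed_eq, mem_ball_zero_iff] at h1
    exact (norm_le_pi_norm z i).trans h1.le
  set b : Fin d → ℝ := fun i => a i + 2 * ε with hb
  set s := h - 4 * ε with hs
  have hs0 : 0 < s := by linarith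
  have hcoord : ∀ w ∈ Set.Icc (0 : Fin d → ℝ) 1, ∀ z : Fin d → ℝ,
      (∀ i, |(z - (b + s • w)) i| ≤ ε) → ∀ i, a i + ε ≤ z i ∧ z i ≤ a i + h - ε := by
    intro w hw z hz i
    have h1 := abs_le.1 (hz i)
    simp only [Pi.sub_apply, Pi.add_apply, Pi.smul_apply, smul_eq_mul, hb] at h1
    have w0 : 0 ≤ w i := hw.1 i
    have w1 : w i ≤ 1 := hw.2 i
    have := mul_nonneg hs0.le w0
    have := mul_le_of_le_one_right hs0.le w1
    constructor <;> linarith [h1.1, h1.2]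
  have hopen : ∀ w ∈ Set.Icc (0 : Fin d → ℝ) 1, ∀ z : Fin d → ℝ,
      (∀ i, |(z - (b + s • w)) i| ≤ ε) → z ∈ openCube d := by
    intro w hw z hz i _
    have := hcoord w hw z hz i
    have h0 := ha0 i
    have h1 := ha1 i
    exact ⟨by linarith [this.1], by linarith [this.2]⟩
  have hnot : ∀ w ∈ Set.Icc (0 : Fin d → ℝ) 1, ∀ z ∉ openCube d, φ (z - (b + s • w)) = 0 := by
    intro w hw z hz
    by_contra hne
    exact hz (hopen w hw z (hzero _ hne))
  refine ⟨φ, b, s, hφc, bump.hasCompactSupport_normed, hφ0, ?_, hs0, by linarith, ?_, ?_, ?_⟩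
  · rw [← ofReal_integral_eq_lintegral_ofReal bump.integrable_normed
      (Filter.Eventually.of_forall hφ0), hφ1, ENNReal.ofReal_one]
  · intro α w hw'
    have h1 := hw.2 α (fun z => φ (z - (b + s • w))) (by fun_prop)
      (bump.hasCompactSupport_normed.comp_homeomorph (Homeomorph.subRight (b + s • w))) (by
        have hcl : IsClosed {z : Fin d → ℝ | ∀ i, |(z - (b + s • w)) i| ≤ ε} := by
          simp only [Set.ofPred_forall]
          exact isClosed_iInter fun i => isClosed_le (by fun_prop) continuous_const
        exact (closure_minimal (fun z hz => hzero _ hz) hcl).trans fun z hz => hopen w hw' z hz)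
    simpa only [iteratedFDeriv_comp_sub] using h1
  · intro w hw z hz
    by_contra hne
    refine hz fun i _ => ?_
    have := hcoord w hw z (hzero _ hne) i
    exact ⟨by linarith [this.1], by linarith [this.2]⟩
  · intro x hx
    have hfi : IntegrableOn f (openCube d) :=
      (hf.integrableOn_compact isCompact_Icc).mono_set (openCube_subset_Icc d)
    have hφi : Integrable fun z => φ (z - (b + s • x)) :=
      bump.integrable_normed.comp_sub_right _
    have hone : ∫ z in openCube d, φ (z - (b + s • x)) = 1 := by
      rw [setIntegral_eq_integral_of_forall_compl_eq_zero (hnot x hx),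
        integral_sub_right_eq_self φ (b + s • x), hφ1]
    obtain ⟨C, hC⟩ := bump.hasCompactSupport_normed.exists_bound_of_continuous
      (f := φ) hφc.continuous
    have hfφ : IntegrableOn (fun z => f z * φ (z - (b + s • x))) (openCube d) :=
      hfi.mul_bdd (c := C) (by fun_prop) (Filter.Eventually.of_forall fun z => hC _)
    have e : mollified φ f b s x - f (a + h • x)
        = ∫ z in openCube d, (f z - f (a + h • x)) * φ (z - (b + s • x)) := by
      simp_rw [sub_mul]
      rw [integral_sub hfφ (hφi.restrict.const_mul _), integral_const_mul, hone, mul_one,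
        mollified]
    rw [e, ← Real.norm_eq_abs]
    have hpx : a + h • x ∈ Set.Icc (0 : Fin d → ℝ) 1 := by
      constructor
      · intro i
        have := mul_nonneg hh.le (hx.1 i)
        simp only [Pi.zero_apply, Pi.add_apply, Pi.smul_apply, smul_eq_mul] at *
        linarith [ha0 i]
      · intro i
        have := mul_le_of_le_one_right hh.le (hx.2 i)
        simp only [Pi.one_apply, Pi.add_apply, Pi.smul_apply, smul_eq_mul] at *
        linarith [ha1 i]
    calc _ ≤ ∫ z in openCube d, η * φ (z - (b + s • x)) := by
          refine norm_integral_le_of_norm_le (hφi.restrict.const_mul _)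
            (ae_restrict_of_forall_mem measurableSet_openCube fun z hz => ?_)
          rw [norm_mul, Real.norm_of_nonneg (hφ0 _)]
          by_cases hne : φ (z - (b + s • x)) = 0
          · rw [hne]; simp
          · refine mul_le_mul_of_nonneg_right ?_ (hφ0 _)
            rw [← dist_eq_norm]
            refine hfδ z (openCube_subset_Icc d hz) _ hpx ?_
            rw [dist_pi_le_iff hδ.le]
            intro i
            have h1 := abs_le.1 (hzero _ hne i)
            have x0 : 0 ≤ x i := hx.1 i
            have x1 : x i ≤ 1 := hx.2 i
            simp only [Pi.sub_apply, Pi.add_apply, Pi.smul_apply, smul_eq_mul, hb, hs] at h1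
            rw [Real.dist_eq, abs_le]
            simp only [Pi.add_apply, Pi.smul_apply, smul_eq_mul]
            have := mul_nonneg hε.le x0
            have := mul_le_of_le_one_right hε.le x1
            constructor <;> nlinarith [h1.1, h1.2]
      _ = η := by rw [integral_const_mul, hone, mul_one]

/-- The measure with density `|D^k f|²` on the open unit cube. -/
noncomputable def derivMeasure {d k : ℕ} (g : (Fin k → Fin d) → (Fin d → ℝ) → ℝ) :
    Measure (Fin d → ℝ) :=
  (volume.restrict (openCube d)).withDensity fun z => ∑ α, ‖g α z‖ₑ ^ 2

/-- The tensor product Lagrange interpolation error on a cube. -/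
theorem exists_interpolation_error_bound (k d : ℕ) (hk : (d : ℝ) / 2 < k) :
    ∃ C : ℝ≥0∞, C ≠ ⊤ ∧ ∀ (f : (Fin d → ℝ) → ℝ) (g : (Fin k → Fin d) → (Fin d → ℝ) → ℝ),
      ContinuousOn f (Set.Icc 0 1) → HasWeakDeriv k f g → (∀ α, Measurable (g α)) →
      ∀ (a : Fin d → ℝ) (h : ℝ), 0 < h → (∀ i, 0 ≤ a i) → (∀ i, a i + h ≤ 1) →
      ∀ x ∈ Set.Icc (0 : Fin d → ℝ) 1,
      ‖f (a + h • x) - ∑ i : Fin d → Fin k, tensorLagrange i x * f (a + h • nodePoint i)‖ₑ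
        ≤ C * (ENNReal.ofReal (h ^ ((k : ℝ) - d / 2)) *
          (derivMeasure g (cube a h)) ^ (1 / 2 : ℝ)) := by
  have hk0 : 0 < k := by
    have : (0 : ℝ) < k := lt_of_le_of_lt (by positivity) hk
    exact_mod_cast this
  obtain ⟨K, hK0, hK⟩ := exists_tensorLagrange_bound d k
  refine ⟨(1 + (k : ℝ≥0∞) ^ d * ENNReal.ofReal K) * (kernelConst k d * (d : ℝ≥0∞) ^ k), ?_, ?_⟩
  · have := (kernelConst_lt_top k d hk).ne
    finiteness
  intro f g hf hw hg a h hh ha0 ha1 x hx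
  refine ENNReal.le_of_forall_pos_le_add fun η hη _ => ?_
  -- Replacing `f` by its mollification costs one error at `x` and `k^d` errors at the nodes, each
  -- weighted by at most `K`; together they give `η`.
  obtain ⟨φ, b, s, h1, h2, h3, h4, hs0, hsh, hweak, hsupp, happ⟩ :=
    exists_mollifier hf hw a hh ha0 ha1 (η := η / (1 + k ^ d * K)) (by positivity)
  have hfi : IntegrableOn f (openCube d) :=
    (hf.integrableOn_compact isCompact_Icc).mono_set (openCube_subset_Icc d)
  have main := mollified_interpolation_error hk0 h1 h2 h3 h4 hfi hg b hs0 hweak (cube a h)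
    (measurableSet_cube a h) hsupp hK x hx
  have e : f (a + h • x) - ∑ i : Fin d → Fin k, tensorLagrange i x * f (a + h • nodePoint i)
      = (mollified φ f b s x
        - ∑ i : Fin d → Fin k, tensorLagrange i x * mollified φ f b s (nodePoint i))
        + (-(mollified φ f b s x - f (a + h • x)) + ∑ i : Fin d → Fin k,
          tensorLagrange i x * (mollified φ f b s (nodePoint i) - f (a + h • nodePoint i))) := by
    simp only [mul_sub, Finset.sum_sub_distrib]
    ring
  rw [e]
  refine (enorm_add_le _ _).trans (add_le_add (main.trans ?_) ?_)
  · rw [mul_assoc, mul_assoc, mul_left_comm ((d : ℝ≥0∞) ^ k)]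
    gcongr
    calc _ ≤ ∑ _α : Fin k → Fin d, derivMeasure g (cube a h) ^ (1 / 2 : ℝ) := by
          refine Finset.sum_le_sum fun α _ => ?_
          gcongr
          rw [derivMeasure, withDensity_apply _ (measurableSet_cube a h)]
          refine lintegral_mono fun z => ?_
          exact Finset.single_le_sum (f := fun α => ‖g α z‖ₑ ^ 2) (fun _ _ => zero_le)
            (Finset.mem_univ α)
      _ = _ := by
        rw [Finset.sum_const, Finset.card_univ, nsmul_eq_mul]
        simp
  · rw [← ofReal_norm, ← ENNReal.ofReal_coe_nnreal]
    refine ENNReal.ofReal_le_ofReal ?_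
    set η' : ℝ := η / (1 + k ^ d * K) with hη'
    have hpos : (0 : ℝ) < 1 + k ^ d * K := by positivity
    calc _ ≤ η' + ∑ _i : Fin d → Fin k, K * η' := by
          refine (norm_add_le _ _).trans (add_le_add ?_ ?_)
          · rw [norm_neg]; exact happ x hx
          · refine (norm_sum_le _ _).trans (Finset.sum_le_sum fun i _ => ?_)
            rw [norm_mul]
            exact mul_le_mul (hK i x hx) (happ _ (nodePoint_mem i)) (norm_nonneg _) hK0
      _ = (1 + k ^ d * K) * η' := by
          rw [Finset.sum_const, Finset.card_univ, nsmul_eq_mul]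
          simp
          ring
      _ = η := by rw [hη']; field_simp

/-! ### Grid points in cubes of a normal system -/

theorem cube_bounds {d : ℕ} {a : Fin d → ℝ} {h : ℝ} (hh : 0 < h)
    (hs : cube a h ⊆ Set.Icc 0 1) (i : Fin d) : 0 ≤ a i ∧ a i + h ≤ 1 := by
  have ha : a ∈ cube a h := fun j _ => ⟨le_rfl, by linarith⟩
  refine ⟨(hs ha).1 i, ?_⟩
  by_contra! hlt
  have hmax : max (a i) 1 < a i + h := max_lt (by linarith) hlt
  obtain ⟨v, hv1, hv2⟩ := exists_between hmax
  have hmem : Function.update a i v ∈ cube a h := by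
    intro j _
    by_cases hj : j = i
    · subst hj
      rw [Function.update_self]
      exact ⟨(le_max_left _ _).trans hv1.le, hv2⟩
    · rw [Function.update_of_ne hj]
      exact ⟨le_rfl, by linarith⟩
  have := (hs hmem).2 i
  rw [Function.update_self] at this
  have h2 := (le_max_right (a i) 1).trans_lt hv1
  simp only [Pi.one_apply] at this
  linarith

theorem cube_subset_Icc {d : ℕ} {a : Fin d → ℝ} {h : ℝ} (ha0 : ∀ i, 0 ≤ a i)
    (ha1 : ∀ i, a i + h ≤ 1) : cube a h ⊆ Set.Icc 0 1 := fun _ hx =>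
  ⟨fun i => (ha0 i).trans (hx i trivial).1, fun i => (hx i trivial).2.le.trans (ha1 i)⟩

theorem volume_real_cube {d : ℕ} (a : Fin d → ℝ) {h : ℝ} (hh : 0 ≤ h) :
    volume.real (cube a h) = h ^ d := by
  rw [measureReal_def, cube, Real.volume_pi_Ico_toReal fun i => by simpa using hh]
  simp

/-- The count is at least `⌈N(a+h)⌉ - ⌈Na⌉`, which is at least one and exceeds `N h - 1`. The first
bound serves for `N h ≤ 2`, the second beyond. -/
theorem card_filter_fin_ge {N : ℕ} {a h : ℝ} (ha : 0 ≤ a) (hah : a + h ≤ 1)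
    (hN : 1 ≤ N * h) :
    N * h / 2 ≤ ((Finset.univ.filter fun t : Fin N =>
      ((t : ℕ) : ℝ) / N ∈ Set.Ico a (a + h)).card : ℝ) := by
  have hN0 : (0 : ℝ) < N := by
    rcases Nat.eq_zero_or_pos N with h0 | h0
    · subst h0; norm_num at hN
    · exact_mod_cast h0
  set p := ⌈N * a⌉₊
  set q := ⌈N * (a + h)⌉₊
  have hq : q ≤ N := Nat.ceil_le.2 (by nlinarith)
  have hlt : ∀ m ∈ Finset.Ico p q, m < N := fun m hm =>
    (Finset.mem_Ico.1 hm).2.trans_le hq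
  have hsub : Finset.attachFin (Finset.Ico p q) hlt ⊆ Finset.univ.filter fun t : Fin N =>
      ((t : ℕ) : ℝ) / N ∈ Set.Ico a (a + h) := by
    intro t ht
    rw [Finset.mem_attachFin, Finset.mem_Ico] at ht
    rw [Finset.mem_filter]
    refine ⟨Finset.mem_univ _, ?_, ?_⟩
    · rw [le_div_iff₀ hN0, mul_comm]
      exact Nat.ceil_le.1 ht.1
    · rw [div_lt_iff₀ hN0, mul_comm (a + h)]
      exact Nat.lt_ceil.1 ht.2
  have hcard := Finset.card_le_card hsub
  rw [Finset.card_attachFin, Nat.card_Ico] at hcard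
  have h1 : (p : ℝ) < N * a + 1 := Nat.ceil_lt_add_one (by positivity)
  have h2 : N * (a + h) ≤ (q : ℝ) := Nat.le_ceil _
  have h3 : p + 1 ≤ q := by
    have : (p : ℝ) < q := by nlinarith
    exact_mod_cast this
  have h4 : (q : ℝ) - p ≤ ((Finset.univ.filter fun t : Fin N =>
      ((t : ℕ) : ℝ) / N ∈ Set.Ico a (a + h)).card : ℝ) := by
    rw [← Nat.cast_sub (by omega)]
    exact_mod_cast hcard
  have h5 : (p : ℝ) + 1 ≤ q := by exact_mod_cast h3
  rcases le_total (N * h) 2 with h6 | h6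
  · linarith
  · nlinarith

theorem card_gridIn_ge {d N : ℕ} {a : Fin d → ℝ} {h : ℝ} (ha0 : ∀ i, 0 ≤ a i)
    (ha1 : ∀ i, a i + h ≤ 1) (hN : 1 ≤ N * h) :
    (N * h / 2) ^ d ≤ ((gridIn N (cube a h)).card : ℝ) := by
  have e : gridIn N (cube a h) = Fintype.piFinset fun i =>
      Finset.univ.filter fun t : Fin N => ((t : ℕ) : ℝ) / N ∈ Set.Ico (a i) (a i + h) := by
    ext τ
    simp [gridIn, cube, gridPoint, Fintype.mem_piFinset, Set.mem_pi]
  rw [e, Fintype.card_piFinset, Nat.cast_prod, ← Fin.prod_const]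
  exact Finset.prod_le_prod (fun _ _ => by linarith)
    fun i _ => card_filter_fin_ge (ha0 i) (ha1 i) hN

theorem gridPoint_mem_of_mem_gridIn {d N : ℕ} {B : Set (Fin d → ℝ)} {τ : Fin d → Fin N}
    (h : τ ∈ gridIn N B) : gridPoint N τ ∈ B := by
  classical
  simpa [gridIn] using h

theorem mrNorm_nonneg {d N : ℕ} (𝓑 : Set (Set (Fin d → ℝ))) (y : (Fin d → Fin N) → ℝ) :
    0 ≤ mrNorm 𝓑 y :=
  Real.iSup_nonneg fun _ => div_nonneg (abs_nonneg _) (Real.sqrt_nonneg _)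

theorem abs_sum_gridIn_le {d N : ℕ} {𝓑 : Set (Set (Fin d → ℝ))} (y : (Fin d → Fin N) → ℝ)
    {B : Set (Fin d → ℝ)} (hB : B ∈ 𝓑) (hc : 0 < (gridIn N B).card) :
    |∑ τ ∈ gridIn N B, y τ| ≤ mrNorm 𝓑 y * Real.sqrt (gridIn N B).card := by
  have h := le_ciSup (bddAbove_localSum 𝓑 y) ⟨B, hB⟩
  have hs : 0 < Real.sqrt (gridIn N B).card := Real.sqrt_pos.2 (by exact_mod_cast hc)
  exact (div_le_iff₀ hs).1 h

/-- Every cube that is not too small contains a cube of the normal system with many grid points. -/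
theorem IsNormalSystem.exists_cube_subset {d : ℕ} (hd : 0 < d) {c : ℝ}
    {𝓑 : Set (Set (Fin d → ℝ))} (h𝓑 : IsNormalSystem c 𝓑) {a : Fin d → ℝ} {h : ℝ} (hh : 0 < h)
    (ha0 : ∀ i, 0 ≤ a i) (ha1 : ∀ i, a i + h ≤ 1) {N : ℕ} (hN : c ≤ N * h) :
    ∃ B ∈ 𝓑, B ⊆ cube a h ∧ (N * h / (2 * c)) ^ d ≤ ((gridIn N B).card : ℝ) := by
  have hc := h𝓑.one_lt
  have hc0 : 0 < c := by linarith
  have hh1 : h ≤ 1 := by linarith [ha0 ⟨0, hd⟩, ha1 ⟨0, hd⟩]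
  obtain ⟨B, hB, hsub, hvol⟩ := h𝓑.exists_subset (cube a h)
    ⟨a, h, hh, hh1, rfl, cube_subset_Icc ha0 ha1⟩
  obtain ⟨a', h', hh', -, hBe, hBs⟩ := h𝓑.isCube B hB
  change B = cube a' h' at hBe
  subst hBe
  refine ⟨_, hB, hsub, ?_⟩
  rw [volume_real_cube _ hh.le, volume_real_cube _ hh'.le] at hvol
  -- The volume bound is `h^d / c ≤ h'^d`; weakening `c` to `c^d` permits taking `d`-th roots.
  have hle : h / c ≤ h' := by
    refine le_of_pow_le_pow_left₀ hd.ne' hh'.le (le_trans ?_ hvol)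
    rw [div_pow]
    gcongr
    exact le_self_pow₀ hc.le hd.ne'
  have hb := cube_bounds hh' hBs
  have hNc : 1 ≤ N * (h / c) := by rwa [← mul_div_assoc, one_le_div hc0]
  have hNh : N * (h / c) ≤ N * h' := by gcongr
  refine le_trans ?_ (card_gridIn_ge (fun i => (hb i).1) (fun i => (hb i).2) (hNc.trans hNh))
  have : N * h / (2 * c) = N * (h / c) / 2 := by field_simp
  rw [this]
  gcongr

/-! ### The local sup bound -/

/-- On cubes that are not too small, the multiresolution norm and the weak derivatives control the
supremum of the function. -/
theorem exists_local_bound (k d : ℕ) (hd : 0 < d) (hk : (d : ℝ) / 2 < k) (c : ℝ) (hc : 1 < c) :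
    ∃ A κ : ℝ, 0 < A ∧ 0 < κ ∧ ∀ 𝓑 : Set (Set (Fin d → ℝ)), IsNormalSystem c 𝓑 →
      ∀ (f : (Fin d → ℝ) → ℝ) (g : (Fin k → Fin d) → (Fin d → ℝ) → ℝ),
      ContinuousOn f (Set.Icc 0 1) → HasWeakDeriv k f g → (∀ α, Measurable (g α)) →
      IsFiniteMeasure (derivMeasure g) → ∀ N : ℕ,
      ∀ (a : Fin d → ℝ) (h : ℝ), 0 < h → (∀ i, 0 ≤ a i) → (∀ i, a i + h ≤ 1) → κ ≤ N * h →
      ∀ x ∈ Set.Icc (0 : Fin d → ℝ) 1,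
      |f (a + h • x)| ≤ A * (mrNorm 𝓑 (sample N f) / Real.sqrt (N ^ d) * h ^ (-((d : ℝ) / 2))
        + h ^ ((k : ℝ) - d / 2) * Real.sqrt ((derivMeasure g).real (cube a h))) := by
  have hk0 : 0 < k := by
    have : (0 : ℝ) < k := lt_of_le_of_lt (by positivity) hk
    exact_mod_cast this
  obtain ⟨C, hC, hCE⟩ := exists_interpolation_error_bound k d hk
  obtain ⟨K, hK0, hK⟩ := exists_tensorLagrange_bound d k
  -- With tolerance `1 / (2 k^d)` the `k^d` terms of the interpolant change by at most `M / 2` in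
  -- total. Below, `δ ≤ 1 / k` keeps the small cube attached to a node inside the large one, as the
  -- last node is `1 - 1/k`.
  obtain ⟨δ', hδ', hδη⟩ := exists_tensorLagrange_modulus d k (1 / (2 * (k : ℝ) ^ d)) (by positivity)
  obtain ⟨δ, hδ, hδδ', hδk⟩ : ∃ δ : ℝ, 0 < δ ∧ δ ≤ δ' ∧ δ ≤ 1 / k :=
    ⟨min δ' (1 / k), by positivity, min_le_left _ _, min_le_right _ _⟩
  have hc0 : 0 < c := by linarith
  set L : ℝ := Real.sqrt ((δ / (2 * c)) ^ d) with hL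
  have hL0 : 0 < L := by positivity
  -- The threshold `c / δ` is what makes the small cube of side `h δ` satisfy `c ≤ N h δ`, as
  -- normality requires.
  refine ⟨C.toReal + K * k ^ d * 2 * (1 / L + C.toReal) + 1, c / δ, by positivity, by positivity, ?_⟩
  intro 𝓑 h𝓑 f g hf hw hg hfin N a h hh ha0 ha1 hN x hx
  have hN0 : (0 : ℝ) < N := by
    have : 0 < N * h := lt_of_lt_of_le (by positivity) hN
    exact pos_of_mul_pos_left this hh.le
  have herr := hCE f g hf hw hg a h hh ha0 ha1
  set S := mrNorm 𝓑 (sample N f) with hS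
  have hS0 : 0 ≤ S := mrNorm_nonneg _ _
  set E : ℝ := h ^ ((k : ℝ) - d / 2) * Real.sqrt ((derivMeasure g).real (cube a h)) with hE
  have hE0 : 0 ≤ E := by positivity
  have herr' : ∀ x ∈ Set.Icc (0 : Fin d → ℝ) 1,
      |f (a + h • x) - ∑ i : Fin d → Fin k, tensorLagrange i x * f (a + h • nodePoint i)|
        ≤ C.toReal * E := by
    intro x hx
    have h1 := herr x hx
    rw [← ofReal_norm, ← ENNReal.ofReal_toReal hC, ← ofReal_measureReal,
      ENNReal.ofReal_rpow_of_nonneg measureReal_nonneg (by norm_num), ← Real.sqrt_eq_rpow,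
      ← ENNReal.ofReal_mul (by positivity), ← ENNReal.ofReal_mul (by positivity),
      ENNReal.ofReal_le_ofReal_iff (by positivity)] at h1
    exact h1
  set X : (Fin d → Fin k) → ℝ := fun i => f (a + h • nodePoint i) with hX
  have : Nonempty (Fin d → Fin k) := ⟨fun _ => ⟨0, hk0⟩⟩
  obtain ⟨i₀, -, hi₀⟩ := Finset.exists_max_image Finset.univ (fun i => |X i|)
    (Finset.univ_nonempty (α := Fin d → Fin k))
  set M := |X i₀| with hM
  have hXM : ∀ i, |X i| ≤ M := fun i => hi₀ i (Finset.mem_univ i)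
  set σ : ℝ := S / Real.sqrt (N ^ d) * h ^ (-((d : ℝ) / 2)) with hσ
  have hσ0 : 0 ≤ σ := by positivity
  -- the node with the largest value
  have hMbound : M ≤ σ / L + (C.toReal * E + M / 2) := by
    have hnode : ∀ m, a m + h * nodePoint i₀ m + h * δ ≤ 1 := by
      intro m
      have h1 := node_add_le_one k (i₀ m)
      have h2 : h * (node k (i₀ m) + δ) ≤ h * 1 := by gcongr; linarith
      have h3 := ha1 m
      simp only [nodePoint]
      linarith
    obtain ⟨B, hB, hBsub, hcard⟩ := h𝓑.exists_cube_subset hd (a := a + h • nodePoint i₀)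
      (h := h * δ) (by positivity)
      (fun m => by
        have := mul_nonneg hh.le ((nodePoint_mem i₀).1 m)
        simp only [Pi.add_apply, Pi.smul_apply, smul_eq_mul] at *
        linarith [ha0 m])
      (fun m => by simpa using hnode m) (N := N) (by
        rw [div_le_iff₀ hδ] at hN; linarith)
    set n : ℝ := ((gridIn N B).card : ℝ) with hn
    have hnpos : 0 < n := lt_of_lt_of_le (by positivity) hcard
    have hcpos : 0 < (gridIn N B).card := Nat.cast_pos.1 hnpos
    have hsum := abs_sum_gridIn_le (sample N f) hB hcpos
    have hpt : ∀ τ ∈ gridIn N B, |X i₀ - sample N f τ| ≤ C.toReal * E + M / 2 := by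
      intro τ hτ
      have hτB : gridPoint N τ ∈ cube (a + h • nodePoint i₀) (h * δ) :=
        hBsub (gridPoint_mem_of_mem_gridIn hτ)
      set z : Fin d → ℝ := h⁻¹ • (gridPoint N τ - a) with hz
      have hgz : a + h • z = gridPoint N τ := by
        rw [hz, smul_inv_smul₀ hh.ne']; abel
      have hzc : ∀ m, nodePoint i₀ m ≤ z m ∧ z m < nodePoint i₀ m + δ := by
        intro m
        have h1 := hτB m trivial
        rw [← hgz] at h1
        simp only [Pi.add_apply, Pi.smul_apply, smul_eq_mul, Set.mem_Ico] at h1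
        exact ⟨le_of_mul_le_mul_left (by linarith [h1.1]) hh,
          lt_of_mul_lt_mul_left (by linarith [h1.2]) hh.le⟩
      have hzmem : z ∈ Set.Icc (0 : Fin d → ℝ) 1 := by
        refine ⟨fun m => ((nodePoint_mem i₀).1 m).trans (hzc m).1, fun m => ?_⟩
        have h1 := node_add_le_one k (i₀ m)
        have h2 := (hzc m).2
        simp only [nodePoint, Pi.one_apply] at *
        linarith
      have hdist : dist z (nodePoint i₀) ≤ δ' := by
        rw [dist_pi_le_iff hδ'.le]
        intro m
        rw [Real.dist_eq, abs_le]
        constructor <;> linarith [(hzc m).1, (hzc m).2]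
      have h1 := herr' z hzmem
      rw [hgz] at h1
      have h2 : |X i₀ - ∑ i, tensorLagrange i z * X i| ≤ M / 2 := by
        have e : X i₀ = ∑ i, tensorLagrange i (nodePoint i₀) * X i := by
          simp [tensorLagrange_nodePoint]
        rw [e, ← Finset.sum_sub_distrib]
        calc _ ≤ ∑ i : Fin d → Fin k, |tensorLagrange i (nodePoint i₀) * X i
              - tensorLagrange i z * X i| := Finset.abs_sum_le_sum_abs _ _
          _ ≤ ∑ _i : Fin d → Fin k, 1 / (2 * (k : ℝ) ^ d) * M := by
            refine Finset.sum_le_sum fun i _ => ?_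
            rw [← sub_mul, abs_mul, abs_sub_comm]
            exact mul_le_mul (hδη i z hzmem _ (nodePoint_mem i₀) hdist) (hXM i) (abs_nonneg _)
              (by positivity)
          _ = M / 2 := by
            rw [Finset.sum_const, Finset.card_univ, nsmul_eq_mul]
            simp only [Fintype.card_fun, Fintype.card_fin, Nat.cast_pow]
            field_simp
      have h3 : X i₀ - sample N f τ = (X i₀ - ∑ i, tensorLagrange i z * X i)
          - (f (gridPoint N τ) - ∑ i, tensorLagrange i z * X i) := by
        rw [sample]; ring
      rw [h3]
      exact (abs_sub _ _).trans (by linarith)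
    -- On `B` the samples are all close to the extremal nodal value, so no cancellation can hide it:
    -- their sum is nearly `n X i₀`, while the multiresolution norm bounds it by `S √n`.
    have hsum2 : n * M ≤ S * Real.sqrt n + n * (C.toReal * E + M / 2) := by
      have e : n * X i₀ = ∑ τ ∈ gridIn N B, sample N f τ
          + ∑ τ ∈ gridIn N B, (X i₀ - sample N f τ) := by
        rw [← Finset.sum_add_distrib]
        simp [hn]
      have h1 : n * M = |n * X i₀| := by rw [abs_mul, abs_of_pos hnpos]
      rw [h1, e]
      refine (abs_add_le _ _).trans (add_le_add hsum ?_)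
      refine (Finset.abs_sum_le_sum_abs _ _).trans ((Finset.sum_le_sum hpt).trans_eq ?_)
      rw [Finset.sum_const, nsmul_eq_mul]
    have hsq : 0 < Real.sqrt n := Real.sqrt_pos.2 hnpos
    have hsn : Real.sqrt n * Real.sqrt n = n := Real.mul_self_sqrt hnpos.le
    have h4 : S / Real.sqrt n ≤ σ / L := by
      have e : σ / L = S / (Real.sqrt (N ^ d) * h ^ ((d : ℝ) / 2) * L) := by
        rw [hσ, Real.rpow_neg hh.le]; field_simp
      rw [e]
      have e2 : h ^ ((d : ℝ) / 2) = Real.sqrt (h ^ d) := by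
        rw [Real.sqrt_eq_rpow, ← Real.rpow_natCast, ← Real.rpow_mul hh.le]; ring_nf
      rw [e2, hL, ← Real.sqrt_mul (by positivity), ← Real.sqrt_mul (by positivity)]
      have e3 : ((N : ℝ) ^ d * h ^ d * (δ / (2 * c)) ^ d) = (N * (h * δ) / (2 * c)) ^ d := by
        rw [← mul_pow, ← mul_pow]; congr 1; ring
      rw [e3]
      gcongr
    have h5 : M ≤ S / Real.sqrt n + (C.toReal * E + M / 2) := by
      have h6 : n * M ≤ n * (S / Real.sqrt n + (C.toReal * E + M / 2)) := by
        have : n * (S / Real.sqrt n) = S * Real.sqrt n := by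
          nth_rewrite 1 [← hsn]; field_simp
        rw [mul_add, this]; exact hsum2
      exact le_of_mul_le_mul_left h6 hnpos
    linarith
  have hM2 : M ≤ 2 * (σ / L + C.toReal * E) := by linarith
  have hfx : |f (a + h • x)| ≤ C.toReal * E + k ^ d * (K * M) := by
    have h1 := herr' x hx
    have h2 : |∑ i : Fin d → Fin k, tensorLagrange i x * X i| ≤ k ^ d * (K * M) := by
      calc _ ≤ ∑ i : Fin d → Fin k, |tensorLagrange i x * X i| := Finset.abs_sum_le_sum_abs _ _
        _ ≤ ∑ _i : Fin d → Fin k, K * M := by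
          refine Finset.sum_le_sum fun i _ => ?_
          rw [abs_mul]
          exact mul_le_mul (hK i x hx) (hXM i) (abs_nonneg _) hK0
        _ = _ := by
          rw [Finset.sum_const, Finset.card_univ, nsmul_eq_mul]
          simp
    have h3 := abs_sub_abs_le_abs_sub (f (a + h • x)) (∑ i : Fin d → Fin k, tensorLagrange i x * X i)
    linarith
  have hC0 : 0 ≤ C.toReal := ENNReal.toReal_nonneg
  have h1 : (k : ℝ) ^ d * (K * M) ≤ k ^ d * (K * (2 * (σ / L + C.toReal * E))) := by gcongr
  have p1 : 0 ≤ C.toReal * σ := by positivity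
  have p2 : 0 ≤ K * k ^ d * 2 * C.toReal * σ := by positivity
  have p3 : 0 ≤ K * k ^ d * 2 * (1 / L) * E := by positivity
  have e : (k : ℝ) ^ d * (K * (2 * (σ / L + C.toReal * E)))
      = K * k ^ d * 2 * (1 / L) * σ + K * k ^ d * 2 * C.toReal * E := by ring
  nlinarith

/-! ### Dyadic subdivision and the stopping time argument -/

/-- The corners of the `2 ^ d` dyadic children of the cube with corner `a` and side `h`. -/
noncomputable def childCorner {d : ℕ} (a : Fin d → ℝ) (h : ℝ) (b : Fin d → Bool) : Fin d → ℝ :=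
  fun i => a i + if b i then h / 2 else 0

theorem cube_subset_iUnion_child {d : ℕ} (a : Fin d → ℝ) (h : ℝ) :
    cube a h ⊆ ⋃ b, cube (childCorner a h b) (h / 2) := by
  intro x hx
  rw [Set.mem_iUnion]
  refine ⟨fun i => decide (a i + h / 2 ≤ x i), fun i _ => ?_⟩
  have h1 := hx i trivial
  simp only [childCorner, decide_eq_true_eq, Set.mem_Ico] at h1 ⊢
  split_ifs with hi
  · exact ⟨hi, by linarith [h1.2]⟩
  · exact ⟨by linarith [h1.1], by linarith [not_le.1 hi]⟩

theorem child_subset_cube {d : ℕ} (a : Fin d → ℝ) {h : ℝ} (hh : 0 < h) (b : Fin d → Bool) :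
    cube (childCorner a h b) (h / 2) ⊆ cube a h := by
  intro x hx i _
  have h1 := hx i trivial
  simp only [childCorner, Set.mem_Ico] at h1 ⊢
  split_ifs at h1
  · exact ⟨by linarith [h1.1], by linarith [h1.2]⟩
  · exact ⟨by linarith [h1.1], by linarith [h1.2]⟩

theorem disjoint_child {d : ℕ} (a : Fin d → ℝ) (h : ℝ) {b b' : Fin d → Bool} (hb : b ≠ b') :
    Disjoint (cube (childCorner a h b) (h / 2)) (cube (childCorner a h b') (h / 2)) := by
  obtain ⟨i, hi⟩ := Function.ne_iff.1 hb
  rw [Set.disjoint_left]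
  intro x hx hx'
  have h1 := hx i trivial
  have h2 := hx' i trivial
  simp only [childCorner, Set.mem_Ico] at h1 h2
  cases hbi : b i <;> cases hbi' : b' i <;> simp_all <;> linarith [h1.1, h1.2, h2.1, h2.2]

theorem sum_measureReal_child_le {d : ℕ} (ν : Measure (Fin d → ℝ)) [IsFiniteMeasure ν]
    (a : Fin d → ℝ) {h : ℝ} (hh : 0 < h) :
    ∑ b, ν.real (cube (childCorner a h b) (h / 2)) ≤ ν.real (cube a h) := by
  rw [← measureReal_biUnion_finset (fun b _ b' _ hb => disjoint_child a h hb)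
    fun b _ => measurableSet_cube _ _]
  exact measureReal_mono (Set.iUnion₂_subset fun b _ => child_subset_cube a hh b)

theorem lintegral_cube_le_sum {d : ℕ} (H : (Fin d → ℝ) → ℝ≥0∞) (a : Fin d → ℝ) (h : ℝ) :
    ∫⁻ x in cube a h, H x ≤ ∑ b, ∫⁻ x in cube (childCorner a h b) (h / 2), H x := by
  refine (lintegral_mono_set (cube_subset_iUnion_child a h)).trans ?_
  refine (lintegral_iUnion_le _ _).trans ?_
  rw [tsum_fintype]

/-- The exponent `p = (4k+2d)/d` satisfies `p d / 2 = 2k + d`; the volume `h^d` then leaves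
`h^(-2k)`, the quantity compared with `ν` in the stopping rule. -/
theorem lintegral_cube_le_of_bound {d k : ℕ} (hd : 0 < d) {f : (Fin d → ℝ) → ℝ} {a : Fin d → ℝ}
    {h M : ℝ} (hh : 0 < h) (hM : 0 ≤ M)
    (hf : ∀ x ∈ cube a h, |f x| ≤ M * h ^ (-((d : ℝ) / 2))) :
    ∫⁻ x in cube a h, ‖f x‖ₑ ^ ((4 * k + 2 * d : ℝ) / d)
      ≤ ENNReal.ofReal (M ^ ((4 * k + 2 * d : ℝ) / d) * (h ^ (2 * k))⁻¹) := by
  have hd' : (0 : ℝ) < d := by exact_mod_cast hd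
  set p : ℝ := (4 * k + 2 * d : ℝ) / d with hp
  have hp0 : 0 ≤ p := by positivity
  calc ∫⁻ x in cube a h, ‖f x‖ₑ ^ p
      ≤ ∫⁻ _x in cube a h, ENNReal.ofReal ((M * h ^ (-((d : ℝ) / 2))) ^ p) := by
        refine setLIntegral_mono' (measurableSet_cube a h) fun x hx => ?_
        rw [← ENNReal.ofReal_rpow_of_nonneg (by positivity) hp0, ← ofReal_norm]
        gcongr
        exact hf x hx
    _ = _ := by
        have hvol : volume (cube a h) = ENNReal.ofReal (h ^ d) := by
          rw [cube, Real.volume_pi_Ico]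
          simp [ENNReal.ofReal_pow hh.le]
        rw [setLIntegral_const, hvol, ← ENNReal.ofReal_mul (by positivity)]
        congr 1
        rw [Real.mul_rpow hM (by positivity), mul_assoc]
        congr 1
        rw [← Real.rpow_natCast, ← Real.rpow_natCast, ← Real.rpow_neg hh.le, ← Real.rpow_mul hh.le,
          ← Real.rpow_add hh]
        congr 1
        rw [hp]
        push_cast
        field_simp
        ring

/-- A stopping time argument: local bounds on all cubes of side at least `h₀ / 2` yield a bound of
the `L^p` norm, `p = (4k + 2d) / d`, on every cube on which the derivatives dominate. -/
theorem lintegral_cube_le_of_local_bound {d k : ℕ} (hd : 0 < d) (hk : 0 < k)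
    (ν : Measure (Fin d → ℝ)) [IsFiniteMeasure ν] {f : (Fin d → ℝ) → ℝ} {A σ h₀ : ℝ}
    (hA : 0 < A) (hσ : 0 < σ) (h₀0 : 0 < h₀) (hνσ : ν.real Set.univ * h₀ ^ (2 * k) ≤ σ ^ 2)
    (hf : ∀ (a : Fin d → ℝ) (h : ℝ), 0 < h → (∀ i, 0 ≤ a i) → (∀ i, a i + h ≤ 1) → h₀ / 2 ≤ h →
      ∀ x ∈ cube a h, |f x| ≤ A * (σ * h ^ (-((d : ℝ) / 2))
        + h ^ ((k : ℝ) - d / 2) * Real.sqrt (ν.real (cube a h))))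
    (m : ℕ) (a : Fin d → ℝ) (h : ℝ) (hh : 0 < h) (ha0 : ∀ i, 0 ≤ a i) (ha1 : ∀ i, a i + h ≤ 1)
    (hm : h < 2 ^ m * h₀) (hν : σ ^ 2 ≤ ν.real (cube a h) * h ^ (2 * k)) :
    ∫⁻ x in cube a h, ‖f x‖ₑ ^ ((4 * k + 2 * d : ℝ) / d)
      ≤ ENNReal.ofReal (2 ^ d * 4 ^ k * (2 * A * σ) ^ ((4 * k + 2 * d : ℝ) / d) *
        (2 * (ν.real (cube a h) / σ ^ 2) - (h ^ (2 * k))⁻¹)) := by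
  -- The number `m` bounds the halvings still possible: a cube of side below `h₀` cannot satisfy
  -- `hν`. The subtracted `h^(-2k)` in the claim is a reserve that grows by `4^k` at each halving
  -- and pays for the stopped siblings, so nested cubes are not charged for `ν` repeatedly.
  induction m generalizing a h with
  | zero =>
    exfalso
    have h1 : ν.real (cube a h) ≤ ν.real Set.univ := measureReal_mono (Set.subset_univ _)
    have h2 : h ^ (2 * k) < h₀ ^ (2 * k) := pow_lt_pow_left₀ (by simpa using hm) hh.le (by omega)
    have h3 : 0 < ν.real (cube a h) := by
      by_contra! hle
      have : ν.real (cube a h) * h ^ (2 * k) ≤ 0 := mul_nonpos_of_nonpos_of_nonneg hle (by positivity)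
      have : 0 < σ ^ 2 := by positivity
      linarith
    have h4 : ν.real (cube a h) * h ^ (2 * k) < ν.real (cube a h) * h₀ ^ (2 * k) := by gcongr
    have h5 : ν.real (cube a h) * h₀ ^ (2 * k) ≤ ν.real Set.univ * h₀ ^ (2 * k) := by gcongr
    linarith
  | succ m ih =>
    set p : ℝ := (4 * k + 2 * d : ℝ) / d with hp
    set J : ℝ := (h ^ (2 * k))⁻¹ with hJ
    have hJ0 : 0 < J := by positivity
    set c₀ : ℝ := (2 * A * σ) ^ p with hc₀
    have hc₀0 : 0 < c₀ := by positivity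
    have hνJ : J ≤ ν.real (cube a h) / σ ^ 2 := by
      rw [hJ, le_div_iff₀ (by positivity), inv_mul_le_iff₀ (by positivity), mul_comm]
      exact hν
    -- Hence the children have side at least `h₀ / 2`, where the local bound is still valid.
    have hhh₀ : h₀ ≤ h := by
      by_contra! hlt
      have h1 : ν.real (cube a h) ≤ ν.real Set.univ := measureReal_mono (Set.subset_univ _)
      have h2 : h ^ (2 * k) < h₀ ^ (2 * k) := pow_lt_pow_left₀ hlt hh.le (by omega)
      have h3 : 0 < ν.real (cube a h) := by
        have : 0 < ν.real (cube a h) / σ ^ 2 := hJ0.trans_le hνJ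
        exact (div_pos_iff_of_pos_right (by positivity)).1 this
      have h4 : ν.real (cube a h) * h ^ (2 * k) < ν.real (cube a h) * h₀ ^ (2 * k) := by gcongr
      have h5 : ν.real (cube a h) * h₀ ^ (2 * k) ≤ ν.real Set.univ * h₀ ^ (2 * k) := by gcongr
      linarith
    set Q : (Fin d → Bool) → Set (Fin d → ℝ) := fun b => cube (childCorner a h b) (h / 2) with hQ
    have hJ4 : ((h / 2) ^ (2 * k))⁻¹ = 4 ^ k * J := by
      rw [hJ, div_pow, inv_div, pow_mul (2 : ℝ)]
      norm_num [div_eq_mul_inv]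
    have hc0 : ∀ b i, 0 ≤ childCorner a h b i := fun b i => by
      unfold childCorner
      have := ha0 i
      split_ifs <;> linarith
    have hc1 : ∀ b i, childCorner a h b i + h / 2 ≤ 1 := fun b i => by
      unfold childCorner
      have := ha1 i
      split_ifs <;> linarith
    have hsmall : ∀ b, ν.real (Q b) * (h / 2) ^ (2 * k) < σ ^ 2 →
        ∫⁻ x in Q b, ‖f x‖ₑ ^ p ≤ ENNReal.ofReal (c₀ * (4 ^ k * J)) := by
      intro b hb
      rw [← hJ4]
      refine lintegral_cube_le_of_bound hd (half_pos hh) (by positivity) fun x hx => ?_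
      refine (hf _ _ (half_pos hh) (hc0 b) (hc1 b) (by linarith) x hx).trans ?_
      have h2 : (h / 2) ^ ((k : ℝ) - d / 2) * Real.sqrt (ν.real (Q b))
          ≤ σ * (h / 2) ^ (-((d : ℝ) / 2)) := by
        rw [sub_eq_add_neg, Real.rpow_add (half_pos hh), mul_right_comm, Real.rpow_natCast]
        gcongr
        refine le_of_sq_le_sq ?_ hσ.le
        rw [mul_pow, Real.sq_sqrt measureReal_nonneg, ← pow_mul, mul_comm k 2, mul_comm]
        exact hb.le
      calc _ ≤ A * (σ * (h / 2) ^ (-((d : ℝ) / 2)) + σ * (h / 2) ^ (-((d : ℝ) / 2))) := by gcongr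
        _ = _ := by ring
    have hgo : ∀ b, σ ^ 2 ≤ ν.real (Q b) * (h / 2) ^ (2 * k) →
        ∫⁻ x in Q b, ‖f x‖ₑ ^ p ≤ ENNReal.ofReal (2 ^ d * 4 ^ k * c₀ *
          (2 * (ν.real (Q b) / σ ^ 2) - 4 ^ k * J)) := by
      intro b hb
      rw [← hJ4]
      exact ih _ _ (half_pos hh) (hc0 b) (hc1 b) (by rw [pow_succ] at hm; linarith) hb
    refine (lintegral_cube_le_sum _ a h).trans ?_
    have h4k : (4 : ℝ) ≤ 4 ^ k := le_self_pow₀ (by norm_num) hk.ne'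
    -- If every child stops, the total cost is a multiple of `J`, and `J ≤ 2 ν / σ² - J` by the
    -- condition on the parent.
    by_cases hall : ∀ b, ν.real (Q b) * (h / 2) ^ (2 * k) < σ ^ 2
    · calc _ ≤ ∑ _b : Fin d → Bool, ENNReal.ofReal (c₀ * (4 ^ k * J)) :=
            Finset.sum_le_sum fun b _ => hsmall b (hall b)
        _ = ENNReal.ofReal (2 ^ d * (c₀ * (4 ^ k * J))) := by
            rw [← ENNReal.ofReal_sum_of_nonneg fun _ _ => by positivity, Finset.sum_const,
              Finset.card_univ, nsmul_eq_mul]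
            simp
        _ ≤ _ := by
            refine ENNReal.ofReal_le_ofReal ?_
            have : 2 ^ d * 4 ^ k * c₀ * J ≤ 2 ^ d * 4 ^ k * c₀ *
              (2 * (ν.real (cube a h) / σ ^ 2) - J) := by gcongr; linarith
            linarith
    · push Not at hall
      obtain ⟨b₀, hb₀⟩ := hall
      -- A stopped child costs `J / 2^d` in units of `2^d 4^k c₀`, hence at most `J` over all
      -- children. The child `b₀` that continues brings a reserve of at least `4 J`, of which `2 J`
      -- is used. The net `-J` is the reserve claimed for the parent.
      set t : (Fin d → Bool) → ℝ := fun b => 2 ^ d * 4 ^ k * c₀ *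
        (2 * (ν.real (Q b) / σ ^ 2) + J / 2 ^ d - if b = b₀ then 2 * J else 0) with ht
      have hJd : 0 ≤ J / 2 ^ d := by positivity
      have hbt : ∀ b, ∫⁻ x in Q b, ‖f x‖ₑ ^ p ≤ ENNReal.ofReal (t b) ∧ 0 ≤ t b := by
        intro b
        rcases lt_or_ge (ν.real (Q b) * (h / 2) ^ (2 * k)) (σ ^ 2) with hb | hb
        · have hne : b ≠ b₀ := by rintro rfl; linarith
          have e : c₀ * (4 ^ k * J) ≤ t b := by
            simp only [ht, if_neg hne, sub_zero]
            have : c₀ * (4 ^ k * J) = 2 ^ d * 4 ^ k * c₀ * (0 + J / 2 ^ d) := by field_simp; ring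
            rw [this]
            gcongr
            positivity
          exact ⟨(hsmall b hb).trans (ENNReal.ofReal_le_ofReal e), le_trans (by positivity) e⟩
        · have h4J : 4 * J ≤ 4 ^ k * J := by gcongr
          have hνb : 4 ^ k * J ≤ ν.real (Q b) / σ ^ 2 := by
            rw [← hJ4, le_div_iff₀ (by positivity), inv_mul_le_iff₀ (by positivity), mul_comm]
            exact hb
          have e : 2 * (ν.real (Q b) / σ ^ 2) - 4 ^ k * J
              ≤ 2 * (ν.real (Q b) / σ ^ 2) + J / 2 ^ d - if b = b₀ then 2 * J else 0 := by
            split_ifs <;> linarith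
          refine ⟨(hgo b hb).trans (ENNReal.ofReal_le_ofReal ?_), ?_⟩
          · simp only [ht]
            gcongr
          · simp only [ht]
            refine mul_nonneg (by positivity) (le_trans ?_ e)
            linarith
      calc _ ≤ ∑ b, ENNReal.ofReal (t b) := Finset.sum_le_sum fun b _ => (hbt b).1
        _ = ENNReal.ofReal (∑ b, t b) :=
            (ENNReal.ofReal_sum_of_nonneg fun b _ => (hbt b).2).symm
        _ ≤ _ := by
            refine ENNReal.ofReal_le_ofReal ?_
            have e : ∑ b, t b = 2 ^ d * 4 ^ k * c₀ *
                (2 * ((∑ b, ν.real (Q b)) / σ ^ 2) + J - 2 * J) := by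
              simp only [ht]
              rw [← Finset.mul_sum, Finset.sum_sub_distrib, Finset.sum_add_distrib,
                ← Finset.mul_sum, ← Finset.sum_div, Finset.sum_const, Finset.card_univ,
                Finset.sum_ite_eq']
              simp only [Finset.mem_univ, if_true, Fintype.card_fun, Fintype.card_bool,
                Fintype.card_fin, nsmul_eq_mul]
              push_cast
              field_simp
            rw [e]
            have hs := sum_measureReal_child_le ν a hh
            have : (∑ b, ν.real (Q b)) / σ ^ 2 ≤ ν.real (cube a h) / σ ^ 2 := by gcongr
            exact mul_le_mul_of_nonneg_left (by linarith) (by positivity)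

/-! ### From local bounds to all `L^q` norms -/

/-- Local bounds on all cubes of side at least `h₀ / 2` yield a bound of the supremum. -/
theorem abs_le_of_local_bound {d k : ℕ} (hk : 0 < k)
    (ν : Measure (Fin d → ℝ)) [IsFiniteMeasure ν] {f : (Fin d → ℝ) → ℝ} {A σ D h₀ : ℝ}
    (hA : 0 < A) (hσ : 0 < σ) (hD : Real.sqrt (ν.real Set.univ) ≤ D)
    (hσD : σ ≤ D) (hDσ : D * h₀ ^ k ≤ σ)
    (hf : ∀ (a : Fin d → ℝ) (h : ℝ), 0 < h → (∀ i, 0 ≤ a i) → (∀ i, a i + h ≤ 1) → h₀ / 2 ≤ h →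
      ∀ x ∈ Set.Icc (0 : Fin d → ℝ) 1, |f (a + h • x)| ≤ A * (σ * h ^ (-((d : ℝ) / 2))
        + h ^ ((k : ℝ) - d / 2) * Real.sqrt (ν.real (cube a h))))
    (x : Fin d → ℝ) (hx : x ∈ Set.Icc (0 : Fin d → ℝ) 1) :
    |f x| ≤ 2 * A * (σ ^ (1 - (d : ℝ) / (2 * k)) * D ^ ((d : ℝ) / (2 * k))) := by
  have hD0 : 0 < D := hσ.trans_le hσD
  have hk' : (0 : ℝ) < k := by exact_mod_cast hk
  -- This side balances the two terms of the local bound: `h^k D = σ`.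
  set h : ℝ := (σ / D) ^ (1 / (k : ℝ)) with hh
  have hh0 : 0 < h := by positivity
  have hhk : h ^ k = σ / D := by
    rw [hh, ← Real.rpow_natCast, ← Real.rpow_mul (by positivity), one_div_mul_cancel hk'.ne',
      Real.rpow_one]
  have hh1 : h ≤ 1 := Real.rpow_le_one (by positivity) ((div_le_one hD0).2 hσD) (by positivity)
  have hhh₀ : h₀ ≤ h := by
    refine le_of_pow_le_pow_left₀ hk.ne' hh0.le ?_
    rw [hhk, le_div_iff₀ hD0, mul_comm]
    exact hDσ
  -- The truncation pushes the cube back into the unit cube while its closure still contains `x`.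
  set a : Fin d → ℝ := fun i => min (x i) (1 - h) with ha
  have hax : a + h • (h⁻¹ • (x - a)) = x := by rw [smul_inv_smul₀ hh0.ne']; abel
  have hmem : h⁻¹ • (x - a) ∈ Set.Icc (0 : Fin d → ℝ) 1 := by
    have hxa : ∀ i, 0 ≤ x i - a i ∧ x i - a i ≤ h := fun i => by
      have h1 : x i ≤ 1 := hx.2 i
      refine ⟨sub_nonneg.2 (min_le_left _ _), ?_⟩
      have : x i - h ≤ a i := le_min (by linarith) (by linarith)
      linarith
    refine ⟨fun i => ?_, fun i => ?_⟩
    · exact mul_nonneg (by positivity) (hxa i).1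
    · simp only [Pi.smul_apply, Pi.sub_apply, smul_eq_mul, Pi.one_apply]
      rw [inv_mul_le_iff₀ hh0, mul_one]
      exact (hxa i).2
  have main := hf a h hh0 (fun i => le_min (hx.1 i) (by linarith))
    (fun i => by have := min_le_right (x i) (1 - h); simp only [ha]; linarith) (by linarith) _ hmem
  rw [hax] at main
  refine main.trans ?_
  have h1 : h ^ ((k : ℝ) - d / 2) * Real.sqrt (ν.real (cube a h))
      ≤ σ * h ^ (-((d : ℝ) / 2)) := by
    rw [sub_eq_add_neg, Real.rpow_add hh0, Real.rpow_natCast, hhk, mul_right_comm]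
    gcongr
    rw [div_mul_eq_mul_div, div_le_iff₀ hD0]
    gcongr
    exact (Real.sqrt_le_sqrt (measureReal_mono (Set.subset_univ _))).trans hD
  have h2 : σ * h ^ (-((d : ℝ) / 2))
      = σ ^ (1 - (d : ℝ) / (2 * k)) * D ^ ((d : ℝ) / (2 * k)) := by
    rw [hh, ← Real.rpow_mul (by positivity), Real.div_rpow hσ.le hD0.le, Real.rpow_sub hσ,
      Real.rpow_one]
    have e : 1 / (k : ℝ) * -((d : ℝ) / 2) = -((d : ℝ) / (2 * k)) := by field_simp
    rw [e, Real.rpow_neg hσ.le, Real.rpow_neg hD0.le]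
    field_simp
  rw [← h2]
  calc _ ≤ A * (σ * h ^ (-((d : ℝ) / 2)) + σ * h ^ (-((d : ℝ) / 2))) := by gcongr
    _ = _ := by ring

/-- Local bounds on all cubes of side at least `h₀ / 2` yield bounds of all `L^r` norms with
`r ≥ (4k + 2d) / d`. -/
theorem eLpNorm_le_of_local_bound {d k : ℕ} (hd : 0 < d) (hk : 0 < k)
    (ν : Measure (Fin d → ℝ)) [IsFiniteMeasure ν] {f : (Fin d → ℝ) → ℝ} {A σ D h₀ : ℝ}
    (hA : 0 < A) (hσ : 0 < σ) (h₀0 : 0 < h₀) (hD : Real.sqrt (ν.real Set.univ) = D)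
    (hσD : σ ≤ D) (hDσ : D * h₀ ^ k ≤ σ) (hν : ν.real (cube 0 1) = ν.real Set.univ)
    (hf : ∀ (a : Fin d → ℝ) (h : ℝ), 0 < h → (∀ i, 0 ≤ a i) → (∀ i, a i + h ≤ 1) → h₀ / 2 ≤ h →
      ∀ x ∈ Set.Icc (0 : Fin d → ℝ) 1, |f (a + h • x)| ≤ A * (σ * h ^ (-((d : ℝ) / 2))
        + h ^ ((k : ℝ) - d / 2) * Real.sqrt (ν.real (cube a h))))
    {r θ : ℝ} (hr : (4 * k + 2 * d : ℝ) / d ≤ r) (hθ : θ = (k - (d : ℝ) / 2 + d * r⁻¹) / (2 * k)) :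
    eLpNorm f (ENNReal.ofReal r) (volume.restrict (Set.Icc 0 1))
      ≤ ENNReal.ofReal (2 * A * (2 ^ (d + 1) * 4 ^ k) * (σ ^ (2 * θ) * D ^ (1 - 2 * θ))) := by
  have hD0 : 0 < D := hσ.trans_le hσD
  have hk' : (0 : ℝ) < k := by exact_mod_cast hk
  have hd' : (0 : ℝ) < d := by exact_mod_cast hd
  set p : ℝ := (4 * k + 2 * d : ℝ) / d with hp
  have hp1 : 1 ≤ p := by rw [hp, one_le_div hd']; linarith
  have hr1 : 1 ≤ r := hp1.trans hr
  have hr0 : 0 < r := by linarith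
  have hνD : ν.real Set.univ = D ^ 2 := by rw [← hD, Real.sq_sqrt measureReal_nonneg]
  have hD2 : D ^ 2 * h₀ ^ (2 * k) ≤ σ ^ 2 := by
    rw [mul_comm 2 k, pow_mul, ← mul_pow]
    gcongr
  set M : ℝ := 2 * A * (σ ^ (1 - (d : ℝ) / (2 * k)) * D ^ ((d : ℝ) / (2 * k))) with hM
  have hM0 : 0 < M := by positivity
  have hsup := abs_le_of_local_bound hk ν hA hσ hD.le hσD hDσ hf
  -- the `L^p` norm
  have hLp : ∫⁻ x in Set.Icc (0 : Fin d → ℝ) 1, ‖f x‖ₑ ^ p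
      ≤ ENNReal.ofReal (2 ^ (d + 1) * 4 ^ k * ((2 * A) ^ p * (σ ^ (p - 2) * D ^ 2))) := by
    have hae : (cube (0 : Fin d → ℝ) 1 : Set (Fin d → ℝ)) =ᵐ[volume] Set.Icc (0 : Fin d → ℝ) 1 := by
      have := Measure.univ_pi_Ico_ae_eq_Icc (μ := fun _ : Fin d => (volume : Measure ℝ))
        (f := fun _ => 0) (g := fun _ => 1)
      simp only [cube, Pi.zero_apply, zero_add]
      exact this
    obtain ⟨m, hm⟩ := pow_unbounded_of_one_lt (1 / h₀) (one_lt_two (α := ℝ))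
    rw [← setLIntegral_congr hae]
    refine (lintegral_cube_le_of_local_bound hd hk ν hA hσ h₀0 (by rw [hνD]; exact hD2) ?_ m 0 1
      one_pos (fun _ => le_rfl) (fun _ => by simp) ?_ ?_).trans (ENNReal.ofReal_le_ofReal ?_)
    · intro a h hh ha0 ha1 hh₀ x hx
      have hax : a + h • (h⁻¹ • (x - a)) = x := by rw [smul_inv_smul₀ hh.ne']; abel
      have := hf a h hh ha0 ha1 hh₀ (h⁻¹ • (x - a)) (by
        refine ⟨fun i => ?_, fun i => ?_⟩
        · exact mul_nonneg (by positivity) (sub_nonneg.2 (hx i trivial).1)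
        · simp only [Pi.smul_apply, Pi.sub_apply, smul_eq_mul, Pi.one_apply]
          rw [inv_mul_le_iff₀ hh, mul_one]
          linarith [(hx i trivial).2])
      rwa [hax] at this
    · rwa [div_lt_iff₀ h₀0] at hm
    · rw [hν, hνD, one_pow, mul_one]
      gcongr
    · rw [hν, hνD, Real.mul_rpow (by positivity) hσ.le, one_pow, inv_one, ← hp]
      have e : σ ^ p = σ ^ (p - 2) * σ ^ 2 := by
        rw [← Real.rpow_natCast σ 2, ← Real.rpow_add hσ]; norm_num
      calc _ ≤ 2 ^ d * 4 ^ k * ((2 * A) ^ p * σ ^ p) * (2 * (D ^ 2 / σ ^ 2)) := by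
            gcongr; linarith
        _ = _ := by rw [e, pow_succ (2 : ℝ) d]; field_simp
  have hrne : ENNReal.ofReal r ≠ 0 := by simpa using hr0
  rw [eLpNorm_eq_lintegral_rpow_enorm_toReal hrne ENNReal.ofReal_ne_top,
    ENNReal.toReal_ofReal hr0.le]
  -- Interpolation between `L^p` and `L^∞`: `|f|^r ≤ M^(r-p) |f|^p`.
  have hint : ∫⁻ x in Set.Icc (0 : Fin d → ℝ) 1, ‖f x‖ₑ ^ r
      ≤ ENNReal.ofReal (M ^ (r - p) *
        (2 ^ (d + 1) * 4 ^ k * ((2 * A) ^ p * (σ ^ (p - 2) * D ^ 2)))) := by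
    rw [ENNReal.ofReal_mul (by positivity)]
    refine le_trans ?_ (mul_le_mul_right hLp _)
    rw [← lintegral_const_mul' _ _ ENNReal.ofReal_ne_top]
    refine setLIntegral_mono' measurableSet_Icc fun x hx => ?_
    have e : r = (r - p) + p := by ring
    conv_lhs => rw [e, ENNReal.rpow_add_of_nonneg _ _ (by linarith) (by linarith)]
    gcongr
    rw [← ENNReal.ofReal_rpow_of_nonneg hM0.le (by linarith), ← ofReal_norm]
    gcongr
    exact hsup x hx
  set c₀ : ℝ := 2 ^ (d + 1) * 4 ^ k with hc₀
  have hc₀1 : 1 ≤ c₀ := by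
    have h1 : (1 : ℝ) ≤ 2 ^ (d + 1) := one_le_pow₀ (by norm_num)
    have h2 : (1 : ℝ) ≤ 4 ^ k := one_le_pow₀ (by norm_num)
    exact one_le_mul_of_one_le_of_one_le h1 h2
  have hval : M ^ (r - p) * (c₀ * ((2 * A) ^ p * (σ ^ (p - 2) * D ^ 2)))
      = (2 * A * (σ ^ (2 * θ) * D ^ (1 - 2 * θ))) ^ r * c₀ := by
    have eσ : σ ^ ((1 - (d : ℝ) / (2 * k)) * (r - p)) * σ ^ (p - 2) = σ ^ (2 * θ * r) := by
      rw [← Real.rpow_add hσ]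
      congr 1
      rw [hθ, hp]
      field_simp
      ring
    have eD : D ^ ((d : ℝ) / (2 * k) * (r - p)) * D ^ 2 = D ^ ((1 - 2 * θ) * r) := by
      rw [← Real.rpow_natCast D 2, ← Real.rpow_add hD0]
      congr 1
      rw [hθ, hp]
      push_cast
      field_simp
      ring
    have eA : (2 * A) ^ (r - p) * (2 * A) ^ p = (2 * A) ^ r := by
      rw [← Real.rpow_add (by positivity)]; congr 1; ring
    rw [hM, Real.mul_rpow (x := 2 * A) (by positivity) (by positivity),
      Real.mul_rpow (x := σ ^ _) (by positivity) (by positivity), ← Real.rpow_mul hσ.le, ← Real.rpow_mul hD0.le,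
      Real.mul_rpow (x := 2 * A) (by positivity) (by positivity),
      Real.mul_rpow (x := σ ^ (2 * θ)) (by positivity) (by positivity), ← Real.rpow_mul hσ.le,
      ← Real.rpow_mul hD0.le, ← eσ, ← eD, ← eA]
    ring
  rw [hval] at hint
  calc _ ≤ (ENNReal.ofReal ((2 * A * (σ ^ (2 * θ) * D ^ (1 - 2 * θ))) ^ r * c₀)) ^ (1 / r) := by
        gcongr
    _ = ENNReal.ofReal (2 * A * (σ ^ (2 * θ) * D ^ (1 - 2 * θ)) * c₀ ^ (1 / r)) := by
        rw [ENNReal.ofReal_rpow_of_nonneg (by positivity) (by positivity),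
          Real.mul_rpow (by positivity) (by positivity), ← Real.rpow_mul (by positivity),
          mul_one_div_cancel hr0.ne', Real.rpow_one]
    _ ≤ _ := by
        refine ENNReal.ofReal_le_ofReal ?_
        have h1 : c₀ ^ (1 / r) ≤ c₀ := by
          conv_rhs => rw [← Real.rpow_one c₀]
          exact Real.rpow_le_rpow_of_exponent_le hc₀1 ((div_le_one hr0).2 hr1)
        calc _ ≤ 2 * A * (σ ^ (2 * θ) * D ^ (1 - 2 * θ)) * c₀ := by gcongr
          _ = _ := by ring

/-- These bounds on the exponent allow a final constant independent of `q`. -/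
theorem vartheta_bounds {k d : ℕ} (hd : 0 < d) (hk : (d : ℝ) / 2 < k) (q : ℝ≥0∞) :
    0 ≤ 2 * vartheta k d q ∧ 2 * vartheta k d q ≤ 1 := by
  have hd' : (0 : ℝ) < d := by exact_mod_cast hd
  have hk' : (0 : ℝ) < k := by linarith
  unfold vartheta
  split_ifs with hq
  · refine ⟨by positivity, ?_⟩
    rw [mul_div_assoc', div_le_one (by positivity)]
    linarith
  · have h1 : 0 ≤ (q⁻¹).toReal := ENNReal.toReal_nonneg
    refine ⟨mul_nonneg zero_le_two (div_nonneg ?_ (by positivity)), ?_⟩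
    · have := mul_nonneg hd'.le h1
      linarith
    · have h2 : (q⁻¹).toReal ≤ ((4 * k + 2 * d : ℝ) / d)⁻¹ := by
        have h3 : q⁻¹ ≤ ENNReal.ofReal ((4 * k + 2 * d : ℝ) / d)⁻¹ := by
          rw [ENNReal.ofReal_inv_of_pos (by positivity)]
          exact ENNReal.inv_le_inv.2 (not_le.1 hq).le
        exact ENNReal.toReal_le_of_le_ofReal (by positivity) h3
      have h4 : (d : ℝ) * (q⁻¹).toReal ≤ d / 2 := by
        have h5 : ((4 * k + 2 * d : ℝ) / d)⁻¹ ≤ 1 / 2 := by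
          rw [inv_div, div_le_div_iff₀ (by positivity) (by positivity)]
          linarith
        nlinarith
      rw [mul_div_assoc', div_le_one (by positivity)]
      linarith

/-- Local bounds on all cubes of side at least `h₀ / 2` yield bounds of all `L^q` norms. -/
theorem eLpNorm_le_vartheta {d k : ℕ} (hd : 0 < d) (hk : 0 < k)
    (ν : Measure (Fin d → ℝ)) [IsFiniteMeasure ν] {f : (Fin d → ℝ) → ℝ} {A σ D h₀ : ℝ}
    (hfc : ContinuousOn f (Set.Icc 0 1))
    (hA : 0 < A) (hσ : 0 < σ) (h₀0 : 0 < h₀) (hD : Real.sqrt (ν.real Set.univ) = D)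
    (hσD : σ ≤ D) (hDσ : D * h₀ ^ k ≤ σ) (hν : ν.real (cube 0 1) = ν.real Set.univ)
    (hf : ∀ (a : Fin d → ℝ) (h : ℝ), 0 < h → (∀ i, 0 ≤ a i) → (∀ i, a i + h ≤ 1) → h₀ / 2 ≤ h →
      ∀ x ∈ Set.Icc (0 : Fin d → ℝ) 1, |f (a + h • x)| ≤ A * (σ * h ^ (-((d : ℝ) / 2))
        + h ^ ((k : ℝ) - d / 2) * Real.sqrt (ν.real (cube a h)))) (q : ℝ≥0∞) :
    eLpNorm f q (volume.restrict (Set.Icc 0 1))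
      ≤ ENNReal.ofReal (2 * A * (2 ^ (d + 1) * 4 ^ k) *
        (σ ^ (2 * vartheta k d q) * D ^ (1 - 2 * vartheta k d q))) := by
  have hD0 : 0 < D := hσ.trans_le hσD
  have hk' : (0 : ℝ) < k := by exact_mod_cast hk
  have hd' : (0 : ℝ) < d := by exact_mod_cast hd
  have hprob : IsProbabilityMeasure (volume.restrict (Set.Icc (0 : Fin d → ℝ) 1)) :=
    ⟨by rw [Measure.restrict_apply_univ, volume_Icc_zero_one]⟩
  by_cases hq : q ≤ ENNReal.ofReal ((4 * k + 2 * d) / d)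
  -- Below the critical exponent `ϑ` is constant and equals the value at that exponent of the
  -- formula for large `q`, so monotonicity of the norms loses nothing.
  · refine (eLpNorm_le_eLpNorm_of_exponent_le hq
      (hfc.aestronglyMeasurable measurableSet_Icc)).trans ?_
    refine eLpNorm_le_of_local_bound hd hk ν hA hσ h₀0 hD hσD hDσ hν hf le_rfl ?_
    rw [vartheta, if_pos hq]
    field_simp
    ring
  · rcases eq_or_ne q ⊤ with rfl | hqt
    · have hsup := abs_le_of_local_bound hk ν hA hσ hD.le hσD hDσ hf
      have hb := eLpNorm_le_of_ae_bound (p := ⊤) (μ := volume.restrict (Set.Icc (0 : Fin d → ℝ) 1))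
        (f := f) (ae_restrict_of_forall_mem measurableSet_Icc hsup)
      refine hb.trans ?_
      rw [measure_univ, ENNReal.one_rpow, one_mul]
      refine ENNReal.ofReal_le_ofReal ?_
      have e : 2 * vartheta k d ⊤ = 1 - (d : ℝ) / (2 * k) := by
        rw [vartheta, if_neg hq]
        simp only [ENNReal.inv_top, ENNReal.toReal_zero, mul_zero, add_zero]
        field_simp
      have e2 : 1 - 2 * vartheta k d ⊤ = (d : ℝ) / (2 * k) := by rw [e]; ring
      rw [e2, e]
      refine mul_le_mul_of_nonneg_right ?_ (by positivity)
      refine le_mul_of_one_le_right (by positivity) ?_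
      have h1 : (1 : ℝ) ≤ 2 ^ (d + 1) := one_le_pow₀ (by norm_num)
      have h2 : (1 : ℝ) ≤ 4 ^ k := one_le_pow₀ (by norm_num)
      exact one_le_mul_of_one_le_of_one_le h1 h2
    · have e : q = ENNReal.ofReal q.toReal := (ENNReal.ofReal_toReal hqt).symm
      have hr : (4 * k + 2 * d : ℝ) / d ≤ q.toReal :=
        (ENNReal.ofReal_le_iff_le_toReal hqt).1 (not_le.1 hq).le
      have h1 := eLpNorm_le_of_local_bound hd hk ν hA hσ h₀0 hD hσD hDσ hν hf hr
        (θ := vartheta k d q) (by rw [vartheta, if_neg hq, ENNReal.toReal_inv])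
      rwa [← e] at h1

/-! ### Assembling the inequality -/

theorem derivMeasure_univ {d k : ℕ} {g : (Fin k → Fin d) → (Fin d → ℝ) → ℝ}
    (hg : ∀ α, Measurable (g α)) :
    derivMeasure g Set.univ = ∑ α, ∫⁻ z in openCube d, ‖g α z‖ₑ ^ 2 := by
  rw [derivMeasure, withDensity_apply _ MeasurableSet.univ, Measure.restrict_univ,
    lintegral_finsetSum _ fun α _ => by have := hg α; fun_prop]

theorem lintegral_enorm_sq_eq {d : ℕ} {g : (Fin d → ℝ) → ℝ}
    (hg : MemLp g 2 (volume.restrict (openCube d))) :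
    ∫⁻ z in openCube d, ‖g z‖ₑ ^ 2 = ENNReal.ofReal (∫ z in openCube d, g z ^ 2) := by
  rw [ofReal_integral_eq_lintegral_ofReal hg.integrable_sq
    (Filter.Eventually.of_forall fun z => sq_nonneg _)]
  refine lintegral_congr fun z => ?_
  rw [← ofReal_norm, ← ENNReal.ofReal_pow (norm_nonneg _), Real.norm_eq_abs, sq_abs]

theorem derivMeasure_univ_eq {d k : ℕ} {g : (Fin k → Fin d) → (Fin d → ℝ) → ℝ}
    (hg : ∀ α, Measurable (g α)) (hL : ∀ α, MemLp (g α) 2 (volume.restrict (openCube d))) :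
    derivMeasure g Set.univ = ENNReal.ofReal (∑ α, ∫ z in openCube d, g α z ^ 2) := by
  rw [derivMeasure_univ hg, ENNReal.ofReal_sum_of_nonneg fun α _ =>
    integral_nonneg fun z => sq_nonneg _]
  exact Finset.sum_congr rfl fun α _ => lintegral_enorm_sq_eq (hL α)

theorem derivMeasure_real_cube_zero_one {d k : ℕ} (g : (Fin k → Fin d) → (Fin d → ℝ) → ℝ) :
    (derivMeasure g).real (cube 0 1) = (derivMeasure g).real Set.univ := by
  refine measureReal_congr ?_
  rw [Filter.eventuallyEq_univ]
  refine (withDensity_absolutelyContinuous _ _).ae_le ?_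
  filter_upwards [ae_restrict_mem measurableSet_openCube] with z hz i _
  exact ⟨(hz i trivial).1.le, by simpa using (hz i trivial).2⟩

theorem HasWeakDeriv.congr_ae {d k : ℕ} {f : (Fin d → ℝ) → ℝ}
    {g g' : (Fin k → Fin d) → (Fin d → ℝ) → ℝ} (h : HasWeakDeriv k f g)
    (hg : ∀ α, g α =ᵐ[volume.restrict (openCube d)] g' α)
    (hg' : ∀ α, LocallyIntegrableOn (g' α) (openCube d)) : HasWeakDeriv k f g' := by
  refine ⟨hg', fun α φ h1 h2 h3 => ?_⟩
  rw [h.2 α φ h1 h2 h3]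
  congr 1
  refine integral_congr_ae ?_
  filter_upwards [hg α] with z hz
  rw [hz]

/-- The multiresolution norm inequality for measurable weak derivatives. -/
theorem exists_mrNorm_bound (k d : ℕ) (hd : 0 < d) (hk : (d : ℝ) / 2 < k) (c : ℝ) (hc : 1 < c) :
    ∃ (C : ℝ) (N₀ : ℕ), 0 < C ∧ ∀ 𝓑 : Set (Set (Fin d → ℝ)), IsNormalSystem c 𝓑 → ∀ q : ℝ≥0∞,
      ∀ (f : (Fin d → ℝ) → ℝ) (g : (Fin k → Fin d) → (Fin d → ℝ) → ℝ),
        ContinuousOn f (Set.Icc 0 1) → HasWeakDeriv k f g → (∀ α, Measurable (g α)) →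
        (∀ α, MemLp (g α) 2 (volume.restrict (openCube d))) →
      ∀ N : ℕ, N₀ ≤ N →
        eLpNorm f q (volume.restrict (Set.Icc 0 1)) ≤ ENNReal.ofReal (C * max (max
          ((mrNorm 𝓑 (sample N f) / Real.sqrt (N ^ d)) ^ (2 * vartheta k d q)
            * derivL2Norm g ^ (1 - 2 * vartheta k d q))
          (mrNorm 𝓑 (sample N f) / Real.sqrt (N ^ d)))
          (derivL2Norm g / (N : ℝ) ^ (2 * k * vartheta k d q))) := by
  have hk0 : 0 < k := by
    have : (0 : ℝ) < k := lt_of_le_of_lt (by positivity) hk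
    exact_mod_cast this
  obtain ⟨A, κ, hA, hκ, hloc⟩ := exists_local_bound k d hd hk c hc
  set C₁ : ℝ := 2 * A * (2 ^ (d + 1) * 4 ^ k) with hC₁
  have hC₁0 : 0 < C₁ := by positivity
  have hC₁A : 2 * A ≤ C₁ := by
    have h1 : (1 : ℝ) ≤ 2 ^ (d + 1) := one_le_pow₀ (by norm_num)
    have h2 : (1 : ℝ) ≤ 4 ^ k := one_le_pow₀ (by norm_num)
    exact le_mul_of_one_le_right (by positivity) (one_le_mul_of_one_le_of_one_le h1 h2)
  set K : ℝ := max 1 (2 * κ) ^ k with hK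
  have hK1 : 1 ≤ K := one_le_pow₀ (le_max_left _ _)
  refine ⟨C₁ * K, ⌈2 * κ⌉₊, by positivity, ?_⟩
  intro 𝓑 h𝓑 q f g hf hw hg hL N hN
  have hNκ : 2 * κ ≤ N := (Nat.le_ceil _).trans (by exact_mod_cast hN)
  have hN0 : (0 : ℝ) < N := by linarith
  have hfin : IsFiniteMeasure (derivMeasure g) :=
    ⟨by rw [derivMeasure_univ_eq hg hL]; exact ENNReal.ofReal_lt_top⟩
  have hsumnn : 0 ≤ ∑ α, ∫ z in openCube d, g α z ^ 2 :=
    Finset.sum_nonneg fun α _ => integral_nonneg fun z => sq_nonneg _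
  have hD : Real.sqrt ((derivMeasure g).real Set.univ) = derivL2Norm g := by
    rw [measureReal_def, derivMeasure_univ_eq hg hL, ENNReal.toReal_ofReal hsumnn, derivL2Norm]
  set D := derivL2Norm g with hDdef
  have hD0 : 0 ≤ D := Real.sqrt_nonneg _
  set σ : ℝ := mrNorm 𝓑 (sample N f) / Real.sqrt (N ^ d) with hσ
  have hσ0 : 0 ≤ σ := div_nonneg (mrNorm_nonneg _ _) (Real.sqrt_nonneg _)
  set θ := vartheta k d q with hθ
  obtain ⟨hθ0, hθ1⟩ := vartheta_bounds hd hk q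
  rw [← hθ] at hθ0 hθ1
  -- Then `h₀ / 2 = κ / N` is the smallest side for which the local bound holds.
  set h₀ : ℝ := 2 * κ / N with hh₀
  have h₀0 : 0 < h₀ := by positivity
  have h₀1 : h₀ ≤ 1 := (div_le_one hN0).2 hNκ
  have hloc' := hloc 𝓑 h𝓑 f g hf hw hg hfin N
  rcases le_or_gt D σ with hcase | hcase
  · -- the local averages dominate
    have hprob : IsProbabilityMeasure (volume.restrict (Set.Icc (0 : Fin d → ℝ) 1)) :=
      ⟨by rw [Measure.restrict_apply_univ, volume_Icc_zero_one]⟩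
    have hsup : ∀ x ∈ Set.Icc (0 : Fin d → ℝ) 1, ‖f x‖ ≤ 2 * A * σ := by
      intro x hx
      have h1 := hloc' 0 1 one_pos (fun _ => le_rfl) (fun _ => by simp) (by linarith) x hx
      rw [zero_add, one_smul, Real.one_rpow, Real.one_rpow, derivMeasure_real_cube_zero_one, hD,
        mul_one, one_mul, ← hσ] at h1
      rw [Real.norm_eq_abs]
      have : A * (σ + D) ≤ A * (σ + σ) := by gcongr
      linarith
    have hb := eLpNorm_le_of_ae_bound (p := q) (μ := volume.restrict (Set.Icc (0 : Fin d → ℝ) 1))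
      (f := f) (ae_restrict_of_forall_mem measurableSet_Icc hsup)
    rw [measure_univ, ENNReal.one_rpow, one_mul] at hb
    refine hb.trans (ENNReal.ofReal_le_ofReal ?_)
    calc 2 * A * σ ≤ C₁ * K * σ := by
          exact mul_le_mul_of_nonneg_right
            (hC₁A.trans (le_mul_of_one_le_right hC₁0.le hK1)) hσ0
      _ ≤ _ := by
          gcongr
          exact (le_max_right _ _).trans (le_max_left _ _)
  · have hDpos : 0 < D := hσ0.trans_lt hcase
    -- Enlarging `σ` keeps the local bound true. It also ensures positivity when `σ = 0` and stops
    -- the subdivision above the grid scale.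
    set s : ℝ := max σ (D * h₀ ^ k) with hs
    have hs0 : 0 < s := lt_max_of_lt_right (by positivity)
    have hsD : s ≤ D := max_le hcase.le (mul_le_of_le_one_right hD0 (pow_le_one₀ h₀0.le h₀1))
    have main := eLpNorm_le_vartheta hd hk0 (derivMeasure g) hf hA hs0 h₀0 hD hsD
      (le_max_right _ _) (derivMeasure_real_cube_zero_one g) (fun a h hh ha0 ha1 hhh x hx => by
        refine (hloc' a h hh ha0 ha1 ?_ x hx).trans ?_
        · rw [hh₀] at hhh
          have : 2 * κ / N / 2 = κ / N := by ring
          rw [this, div_le_iff₀ hN0] at hhh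
          linarith
        · rw [← hσ]
          gcongr
          exact le_max_left _ _) q
    refine main.trans (ENNReal.ofReal_le_ofReal ?_)
    rw [← hC₁, ← hθ, mul_assoc C₁ K]
    refine mul_le_mul_of_nonneg_left ?_ hC₁0.le
    set T := max (max (σ ^ (2 * θ) * D ^ (1 - 2 * θ)) σ) (D / (N : ℝ) ^ (2 * k * θ)) with hT
    have hT0 : 0 ≤ T := hσ0.trans ((le_max_right _ _).trans (le_max_left _ _))
    rcases max_choice σ (D * h₀ ^ k) with hm | hm
    · rw [hs, hm]
      calc _ ≤ T := (le_max_left _ _).trans (le_max_left _ _)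
        _ ≤ K * T := le_mul_of_one_le_left hT0 hK1
    · rw [hs, hm]
      -- The powers of `D` combine to `D`, and `h₀^(2kϑ)` is a constant times `N^(-2kϑ) = n^(-ϑ')`:
      -- this is the third term.
      have e : (D * h₀ ^ k) ^ (2 * θ) * D ^ (1 - 2 * θ)
          = (2 * κ) ^ (2 * k * θ) * (D / (N : ℝ) ^ (2 * k * θ)) := by
        rw [Real.mul_rpow hD0 (by positivity), mul_right_comm, ← Real.rpow_add hDpos,
          ← Real.rpow_natCast, ← Real.rpow_mul h₀0.le, hh₀,
          Real.div_rpow (by positivity) hN0.le]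
        have e1 : 2 * θ + (1 - 2 * θ) = 1 := by ring
        have e2 : (k : ℝ) * (2 * θ) = 2 * k * θ := by ring
        rw [e1, e2, Real.rpow_one]
        ring
      rw [e]
      refine mul_le_mul ?_ (le_max_right _ _) (by positivity) (by positivity)
      calc (2 * κ) ^ (2 * k * θ) ≤ (max 1 (2 * κ)) ^ (2 * k * θ) := by
            refine Real.rpow_le_rpow (by positivity) (le_max_right _ _) ?_
            have : 2 * (k : ℝ) * θ = k * (2 * θ) := by ring
            rw [this]
            positivity
        _ ≤ (max 1 (2 * κ)) ^ (k : ℝ) := by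
            refine Real.rpow_le_rpow_of_exponent_le (le_max_left _ _) ?_
            have : 2 * (k : ℝ) * θ = k * (2 * θ) := by ring
            rw [this]
            exact mul_le_of_le_one_right (by positivity) hθ1
        _ = K := by rw [Real.rpow_natCast]

end MultiresolutionNorm

theorem mainTheorem7 (k d : ℕ) (hd : 0 < d) (hk : (d : ℝ) / 2 < k) (c : ℝ) (hc : 1 < c) :
    ∃ (C : ℝ) (n₀ : ℕ), 0 < C ∧
      ∀ 𝓑 : Set (Set (Fin d → ℝ)), MultiresolutionNorm.IsNormalSystem c 𝓑 →
      ∀ q : ℝ≥0∞, 1 ≤ q →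
      ∀ (f : (Fin d → ℝ) → ℝ) (Dkf : (Fin k → Fin d) → (Fin d → ℝ) → ℝ),
        ContinuousOn f (Set.Icc 0 1) →
        MultiresolutionNorm.HasWeakDeriv k f Dkf →
        (∀ α, MemLp (Dkf α) 2 (volume.restrict (MultiresolutionNorm.openCube d))) →
      ∀ n N : ℕ, n = N ^ d → n₀ ≤ n →
        eLpNorm f q (volume.restrict (Set.Icc 0 1)) ≤
          ENNReal.ofReal (C *
            max (max
              (MultiresolutionNorm.mrNorm 𝓑 (MultiresolutionNorm.sample N f)
                  ^ (2 * MultiresolutionNorm.vartheta k d q)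
                / (n : ℝ) ^ MultiresolutionNorm.vartheta k d q
                * MultiresolutionNorm.derivL2Norm Dkf
                  ^ (1 - 2 * MultiresolutionNorm.vartheta k d q))
              (MultiresolutionNorm.mrNorm 𝓑 (MultiresolutionNorm.sample N f)
                / (n : ℝ) ^ (1 / 2 : ℝ)))
              (MultiresolutionNorm.derivL2Norm Dkf
                / (n : ℝ) ^ (2 * k * MultiresolutionNorm.vartheta k d q / d))) := by
  obtain ⟨C, N₀, hC, h⟩ := MultiresolutionNorm.exists_mrNorm_bound k d hd hk c hc
  refine ⟨C, N₀ ^ d, hC, ?_⟩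
  intro 𝓑 h𝓑 q _ f Dkf hf hw hL n N hn hn₀
  subst hn
  have hd' : (d : ℝ) ≠ 0 := by exact_mod_cast hd.ne'
  have hN : N₀ ≤ N := le_of_pow_le_pow_left₀ hd.ne' (Nat.zero_le _) hn₀
  -- The `L²` derivatives are only almost everywhere measurable; passing to measurable
  -- representatives changes neither the weak derivative property nor the norm.
  set g : (Fin k → Fin d) → (Fin d → ℝ) → ℝ := fun α => (hL α).1.mk (Dkf α) with hg
  have hgae : ∀ α, Dkf α =ᵐ[volume.restrict (MultiresolutionNorm.openCube d)] g α :=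
    fun α => (hL α).1.ae_eq_mk
  have hgL : ∀ α, MemLp (g α) 2 (volume.restrict (MultiresolutionNorm.openCube d)) :=
    fun α => (hL α).ae_eq (hgae α)
  have hfinv : IsFiniteMeasure (volume.restrict (MultiresolutionNorm.openCube d)) :=
    ⟨by
      rw [Measure.restrict_apply_univ]
      refine (measure_mono (MultiresolutionNorm.openCube_subset_Icc d)).trans_lt ?_
      rw [MultiresolutionNorm.volume_Icc_zero_one]
      exact ENNReal.one_lt_top⟩
  have hgw := hw.congr_ae hgae fun α => by
    have h1 : IntegrableOn (g α) (MultiresolutionNorm.openCube d) :=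
      (hgL α).integrable one_le_two
    exact h1.locallyIntegrableOn
  have hD : MultiresolutionNorm.derivL2Norm g = MultiresolutionNorm.derivL2Norm Dkf := by
    unfold MultiresolutionNorm.derivL2Norm
    congr 1
    refine Finset.sum_congr rfl fun α _ => integral_congr_ae ?_
    filter_upwards [hgae α] with z hz
    rw [hz]
  have main := h 𝓑 h𝓑 q f g hf hgw (fun α => (hL α).1.stronglyMeasurable_mk.measurable) hgL N hN
  rw [hD] at main
  refine main.trans_eq ?_
  have e1 : ((N ^ d : ℕ) : ℝ) = (N : ℝ) ^ d := by push_cast; rfl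
  have e2 : ((N : ℝ) ^ d) ^ (1 / 2 : ℝ) = Real.sqrt (N ^ d) := (Real.sqrt_eq_rpow _).symm
  have e3 : ((N : ℝ) ^ d) ^ (2 * k * MultiresolutionNorm.vartheta k d q / d)
      = (N : ℝ) ^ (2 * k * MultiresolutionNorm.vartheta k d q) := by
    rw [← Real.rpow_natCast, ← Real.rpow_mul (Nat.cast_nonneg _)]
    congr 1
    field_simp
  have e4 : (Real.sqrt ((N : ℝ) ^ d)) ^ (2 * MultiresolutionNorm.vartheta k d q)
      = ((N : ℝ) ^ d) ^ MultiresolutionNorm.vartheta k d q := by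
    rw [Real.sqrt_eq_rpow, ← Real.rpow_mul (by positivity)]
    congr 1
    ring
  rw [e1, e2, e3, Real.div_rpow (MultiresolutionNorm.mrNorm_nonneg _ _) (Real.sqrt_nonneg _), e4]
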